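/- **Model.** Let $d\ge 1$, $T\ge 0$, $A\ge 0$, $B,R,C>0$. A $C$-corrupted linear contextual bandit with $T$ rounds consists of a vector $\mu^*\in\mathbb R^d$ with $\|\mu^*\|_2\le B$, a filtration $(\mathcal F_t)$ on a probability space and, in each round $t=1,\dots,T$, a (possibly random, history-dependent) decision set $D_t\subseteq\mathbb R^d$, a noise function $\epsilon_t$, a function $\sigma_t\ge 0$, the stochastic reward function $r'_t(a)=\langle a,\mu^*\rangle+\epsilon_t(a)$, an adversarially chosen reward function $r_t$ on $D_t$, and an action $a_t\in D_t$, after which the agent observes $r_t:=r_t(a_t)$ and $\sigma_t:=\sigma_t(a_t)$. Almost surely, for all $a\in D_t$, $\|a\|_2\le A$, $\langle a,\mu^*\rangle\in[-1,1]$, $|\epsilon_t(a)|\le R$. The $\sigma$-algebra $\mathcal F_t$ contains the information available before the noise of round $t$ is drawn: $a_t$ and $\sigma_t(\cdot)$ are $\mathcal F_t$-measurable, while $\epsilon_t(\cdot)$ and $r_t(a_t)$ are $\mathcal F_{t+1}$-measurable. Moreover $\mathbb E[\epsilon_t(a)\mid\mathcal F_t]=0$ and $\mathbb E[\epsilon_t(a)^2\mid\mathcal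 F_t]\le\sigma_t(a)^2$ for $a\in D_t$; since $D_t$ is random, this and the measurability of $\sigma_t(\cdot),\epsilon_t(\cdot)$ are understood for every $\mathcal F_t$-measurable random $a\in D_t$. The corruption satisfies $$\frac1{R+1}\sum_{t=1}^T\sup_{a\in D_t}|r'_t(a)-r_t(a)|\le C\quad\text{almost surely.}$$ **Algorithm (Robust weighted OFUL, with known $C$).** Let $\lambda=1/B^2$, $\delta\in(0,1)$, $\bar\sigma_t=\max\{(R+1)/\sqrt d,\sigma_t\}$, $\Sigma_t=\lambda I+\sum_{i<t}a_ia_i^\top/\bar\sigma_i^2$, $b_t=\sum_{i<t}r_ia_i/\bar\sigma_i^2$, $\mu_t=\Sigma_t^{-1}b_t$, $$\alpha_t=8\sqrt{d\log\tfrac{(R+1)^2\lambda+tA^2}{(R+1)^2\lambda}\,\log\tfrac{4t^2}{\delta}}+4\sqrt d\,\log\tfrac{4t^2}{\delta}+C\sqrt d+\sqrt\lambda B,$$ and $\mathcal C_t=\{\mu:\|\mu-\mu_t\|_{\Sigma_t}\le\alpha_t\}$, where $\|x\|_\Sigma=\sqrt{x^\top\Sigma x}$. In round $t$ the agent plays some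 $a_t\in\operatorname{argmax}_{a\in D_t}\max_{\mu\in\mathcal C_t}\langle\mu,a\rangle$. Its regret is $\mathrm{Regret}(T)=\sum_{t=1}^T\big(\sup_{a\in D_t}\langle a,\mu^*\rangle-\langle a_t,\mu^*\rangle\big)$. **Theorem.** There is an absolute $k\in\mathbb N$ and, for every $c_0>0$, a constant $K>0$ depending only on $c_0$, such that for every model as above with $C\ge c_0$ and $R\ge c_0$ and every $\delta\in(0,1)$, Robust weighted OFUL satisfies, with probability at least $1-\delta$, $$\mathrm{Regret}(T)\le K\,\Big(\log\big(2+T+AB+\tfrac1\delta\big)\Big)^k\left(C\,d\sqrt{\sum_{t=1}^T\sigma_t^2}+C\,R\sqrt{dT}\right),$$ that is, $\mathrm{Regret}(T)=\tilde O\big(Cd\sqrt{\sum_{t=1}^T\sigma_t^2}+CR\sqrt{dT}\big)$. -/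

import Mathlib

open MeasureTheory
open scoped Matrix ENNReal

noncomputable section

namespace CorruptedBandit

/-- The action space `ℝ^d` with its Euclidean norm and inner product. -/
abbrev Vec (d : ℕ) := EuclideanSpace ℝ (Fin d)

/-! ### The interaction

Rounds are numbered `1, 2, …, T`. -/

/-- The random objects of a run of the protocol on the sample space `Ω`: in round `t` there are the
decision set `D t`, the noise function `noise t`, the function `sd t` of upper bounds on the standard
deviation of the noise, the (possibly corrupted) reward function `reward t`, and the selected
action `act t`. The sigma-algebra `info t` is the information available at round `t` before the noise
of that round is drawn; `theta` is the hidden parameter vector. -/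
structure Run (Ω : Type*) [mΩ : MeasurableSpace Ω] (d : ℕ) where
  theta : Vec d
  D : ℕ → Ω → Set (Vec d)
  noise : ℕ → Vec d → Ω → ℝ
  sd : ℕ → Vec d → Ω → ℝ
  reward : ℕ → Vec d → Ω → ℝ
  act : ℕ → Ω → Vec d
  info : Filtration ℕ mΩ

section Model

variable {Ω : Type*} [mΩ : MeasurableSpace Ω] {d : ℕ}

/-- The uncorrupted stochastic reward `⟨a, θ⟩ + ε_t(a)`. -/
def Run.stochReward (I : Run Ω d) (t : ℕ) (a : Vec d) (ω : Ω) : ℝ :=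
  inner ℝ a I.theta + I.noise t a ω

/-- The corruption level `(1 / (R + 1)) ∑_{t ≤ T} sup_{a ∈ D_t} |r'_t(a) - r_t(a)|`, as an extended
nonnegative real (so that the suprema always make sense). -/
def Run.corruption (I : Run Ω d) (T : ℕ) (R : ℝ) (ω : Ω) : ℝ≥0∞ :=
  (∑ t ∈ Finset.Icc 1 T, ⨆ a ∈ I.D t ω,
    ENNReal.ofReal |I.stochReward t a ω - I.reward t a ω|) / ENNReal.ofReal (R + 1)

/-- The reward `r_t = r_t(a_t)` received in round `t`. -/
def Run.obsReward (I : Run Ω d) (t : ℕ) (ω : Ω) : ℝ := I.reward t (I.act t ω) ω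

/-- The bound `σ_t = σ_t(a_t)` received in round `t`. -/
def Run.obsSd (I : Run Ω d) (t : ℕ) (ω : Ω) : ℝ := I.sd t (I.act t ω) ω

/-- The (pseudo-)regret `∑_{t ≤ T} (sup_{a ∈ D_t} ⟨a, θ⟩ - ⟨a_t, θ⟩)`. -/
def Run.regret (I : Run Ω d) (T : ℕ) (ω : Ω) : ℝ :=
  ∑ t ∈ Finset.Icc 1 T,
    (sSup ((fun a : Vec d => inner ℝ a I.theta) '' I.D t ω) - inner ℝ (I.act t ω) I.theta)

/-- A random action in `D_t` that is determined by the information available at round `t`. -/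
def Run.Admissible (I : Run Ω d) (P : Measure Ω) (t : ℕ) (α : Ω → Vec d) : Prop :=
  Measurable[I.info t] α ∧ ∀ᵐ ω ∂P, α ω ∈ I.D t ω

/-- The assumptions of the `C`-corrupted linear contextual bandit over `T` rounds. Statements on the
noise "for all `a ∈ D_t`" that involve a conditional expectation are made for all random actions
`α ∈ D_t` that are determined by the current information (`D_t` is itself random); deterministic
actions are the special case of a constant `α`. Nothing but the corruption level restricts the rewards
the adversary returns, and the decision sets may depend on the past in any way. -/
structure Run.IsCorruptedBandit (I : Run Ω d) (P : Measure Ω) (T : ℕ) (A B R C : ℝ) : Prop where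
  norm_theta : ‖I.theta‖ ≤ B
  norm_le : ∀ t ∈ Finset.Icc 1 T, ∀ᵐ ω ∂P, ∀ a ∈ I.D t ω, ‖a‖ ≤ A
  mean_le : ∀ t ∈ Finset.Icc 1 T, ∀ᵐ ω ∂P, ∀ a ∈ I.D t ω, |(inner ℝ a I.theta : ℝ)| ≤ 1
  /-- the agent selects `a_t ∈ D_t` on the basis of the information available to it -/
  act_admissible : ∀ t ∈ Finset.Icc 1 T, I.Admissible P t (I.act t)
  sd_nonneg : ∀ t ∈ Finset.Icc 1 T, ∀ᵐ ω ∂P, ∀ a ∈ I.D t ω, 0 ≤ I.sd t a ω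
  /-- the variance bound is known before the noise is drawn -/
  sd_measurable : ∀ t ∈ Finset.Icc 1 T, ∀ α, I.Admissible P t α →
    Measurable[I.info t] (fun ω => I.sd t (α ω) ω)
  /-- the noise and the received reward of round `t` belong to the information at round `t + 1` -/
  noise_measurable : ∀ t ∈ Finset.Icc 1 T, ∀ α, I.Admissible P t α →
    Measurable[I.info (t + 1)] (fun ω => I.noise t (α ω) ω)
  reward_measurable : ∀ t ∈ Finset.Icc 1 T, Measurable[I.info (t + 1)] (I.obsReward t)
  noise_le : ∀ t ∈ Finset.Icc 1 T, ∀ᵐ ω ∂P, ∀ a ∈ I.D t ω, |I.noise t a ω| ≤ R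
  noise_mean : ∀ t ∈ Finset.Icc 1 T, ∀ α, I.Admissible P t α →
    P[fun ω => I.noise t (α ω) ω | I.info t] =ᵐ[P] fun _ => 0
  noise_var : ∀ t ∈ Finset.Icc 1 T, ∀ α, I.Admissible P t α →
    P[fun ω => I.noise t (α ω) ω ^ 2 | I.info t] ≤ᵐ[P] fun ω => I.sd t (α ω) ω ^ 2
  corruption_le : ∀ᵐ ω ∂P, I.corruption T R ω ≤ ENNReal.ofReal C

end Model

/-! ### Robust weighted OFUL

The quantities the algorithm computes from the actions `a`, the received rewards `y` and the received
standard deviation bounds `s` of the rounds before `t`. -/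

section Algorithm

variable {d : ℕ}

/-- The weight `σ̄ = max {(R + 1) / √d, σ}`. -/
def sdBar (d : ℕ) (R s : ℝ) : ℝ := max ((R + 1) / √(d : ℝ)) s

/-- `Σ_t = λ I + ∑_{i < t} a_i a_iᵀ / σ̄_i²`. -/
def gram (lam R : ℝ) (a : ℕ → Vec d) (s : ℕ → ℝ) (t : ℕ) : Matrix (Fin d) (Fin d) ℝ :=
  lam • (1 : Matrix (Fin d) (Fin d) ℝ) +
    ∑ i ∈ Finset.Ico 1 t, (sdBar d R (s i) ^ 2)⁻¹ • Matrix.vecMulVec (a i).ofLp (a i).ofLp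

/-- `b_t = ∑_{i < t} r_i a_i / σ̄_i²`. -/
def moment (R : ℝ) (a : ℕ → Vec d) (s y : ℕ → ℝ) (t : ℕ) : Vec d :=
  ∑ i ∈ Finset.Ico 1 t, (y i / sdBar d R (s i) ^ 2) • a i

/-- `μ_t = Σ_t⁻¹ b_t`. -/
def estimate (lam R : ℝ) (a : ℕ → Vec d) (s y : ℕ → ℝ) (t : ℕ) : Vec d :=
  WithLp.toLp 2 ((gram lam R a s t)⁻¹ *ᵥ (moment R a s y t).ofLp)

/-- The algorithm's initialisation and updates. -/
theorem gram_one (lam R : ℝ) (a : ℕ → Vec d) (s : ℕ → ℝ) : gram lam R a s 1 = lam • 1 := by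
  simp [gram]

theorem moment_one (R : ℝ) (a : ℕ → Vec d) (s y : ℕ → ℝ) : moment R a s y 1 = 0 := by
  simp [moment]

theorem gram_succ (lam R : ℝ) (a : ℕ → Vec d) (s : ℕ → ℝ) (t : ℕ) (ht : 1 ≤ t) :
    gram lam R a s (t + 1) = gram lam R a s t +
      (sdBar d R (s t) ^ 2)⁻¹ • Matrix.vecMulVec (a t).ofLp (a t).ofLp := by
  simp [gram, Finset.sum_Ico_succ_top ht, add_assoc]

theorem moment_succ (R : ℝ) (a : ℕ → Vec d) (s y : ℕ → ℝ) (t : ℕ) (ht : 1 ≤ t) :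
    moment R a s y (t + 1) = moment R a s y t + (y t / sdBar d R (s t) ^ 2) • a t := by
  simp [moment, Finset.sum_Ico_succ_top ht]

/-- `‖x‖_S = √(xᵀ S x)`. -/
def matNorm (S : Matrix (Fin d) (Fin d) ℝ) (x : Vec d) : ℝ :=
  √(x.ofLp ⬝ᵥ (S *ᵥ x.ofLp))

/-- The confidence radius `α_t`, enlarged by `C √d`. -/
def radius (d : ℕ) (lam A B R C δ : ℝ) (t : ℕ) : ℝ :=
  8 * √(d * Real.log (((R + 1) ^ 2 * lam + t * A ^ 2) / ((R + 1) ^ 2 * lam))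
      * Real.log (4 * t ^ 2 / δ))
    + 4 * √(d : ℝ) * Real.log (4 * t ^ 2 / δ) + C * √(d : ℝ) + √lam * B

/-- The confidence ellipsoid `C_t = {μ | ‖μ - μ_t‖_{Σ_t} ≤ α_t}`. -/
def confSet (lam A B R C δ : ℝ) (a : ℕ → Vec d) (s y : ℕ → ℝ) (t : ℕ) : Set (Vec d) :=
  {m | matNorm (gram lam R a s t) (m - estimate lam R a s y t) ≤ radius d lam A B R C δ t}

/-- The optimistic value `max_{μ ∈ S} ⟨μ, x⟩` of an action `x`. -/
def optValue (S : Set (Vec d)) (x : Vec d) : ℝ :=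
  sSup ((fun m : Vec d => inner ℝ m x) '' S)

/-- In each of the rounds `1, …, T` the agent plays according to Robust weighted OFUL: the action `a_t`
maximizes `max_{μ ∈ C_t} ⟨μ, a⟩` over `a ∈ D_t` (ties are broken arbitrarily). -/
def Run.PlaysRobustOFUL {Ω : Type*} [MeasurableSpace Ω] (I : Run Ω d) (P : Measure Ω) (T : ℕ)
    (lam A B R C δ : ℝ) : Prop :=
  ∀ t ∈ Finset.Icc 1 T, ∀ᵐ ω ∂P, I.act t ω ∈ I.D t ω ∧
    IsMaxOn (optValue (confSet lam A B R C δ (fun i => I.act i ω) (fun i => I.obsSd i ω)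
      (fun i => I.obsReward i ω) t)) (I.D t ω) (I.act t ω)

end Algorithm

end CorruptedBandit

end

namespace RobustOFUL

open CorruptedBandit Matrix

/-! ### The dual form `uᵀ Z⁻¹ v` of a positive definite matrix -/

section LinearAlgebra

variable {d : ℕ}

/-- The bilinear form `uᵀ Z⁻¹ v`. -/
noncomputable def invForm (Z : Matrix (Fin d) (Fin d) ℝ) (u v : Fin d → ℝ) : ℝ := u ⬝ᵥ (Z⁻¹ *ᵥ v)

/-- The norm `‖u‖_{Z⁻¹} = √(uᵀ Z⁻¹ u)`. -/
noncomputable def invNorm (Z : Matrix (Fin d) (Fin d) ℝ) (u : Fin d → ℝ) : ℝ := √(invForm Z u u)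

variable {Z : Matrix (Fin d) (Fin d) ℝ} (u v w : Fin d → ℝ)

theorem invForm_add_left : invForm Z (u + v) w = invForm Z u w + invForm Z v w := by
  simp [invForm, add_dotProduct]

theorem invForm_add_right : invForm Z u (v + w) = invForm Z u v + invForm Z u w := by
  simp [invForm, mulVec_add]

theorem invForm_smul_left (c : ℝ) : invForm Z (c • u) v = c * invForm Z u v := by
  simp [invForm]

theorem invForm_smul_right (c : ℝ) : invForm Z u (c • v) = c * invForm Z u v := by
  simp [invForm, mulVec_smul]

theorem invForm_zero_right : invForm Z u 0 = 0 := by simp [invForm]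

theorem invForm_comm (hZ : Z.PosDef) : invForm Z u v = invForm Z v u := by
  have h : (Z⁻¹)ᵀ = Z⁻¹ := by simpa using hZ.inv.isHermitian.eq
  rw [invForm, invForm, dotProduct_mulVec, ← mulVec_transpose, h, dotProduct_comm]

theorem invForm_self_nonneg (hZ : Z.PosDef) : 0 ≤ invForm Z u u := by
  simpa [invForm] using hZ.inv.posSemidef.dotProduct_mulVec_nonneg u

theorem invForm_sq_le (hZ : Z.PosDef) :
    invForm Z u v ^ 2 ≤ invForm Z u u * invForm Z v v := by
  have h : ∀ t : ℝ, 0 ≤ invForm Z v v * (t * t) + (2 * invForm Z u v) * t + invForm Z u u := by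
    intro t
    have := invForm_self_nonneg (u + t • v) hZ
    rw [invForm_add_left, invForm_add_right, invForm_add_right, invForm_smul_left,
      invForm_smul_right, invForm_smul_left, invForm_smul_right, invForm_comm v u hZ] at this
    linarith
  have := discrim_le_zero h
  rw [discrim] at this
  linarith

theorem invNorm_nonneg : 0 ≤ invNorm Z u := Real.sqrt_nonneg _

theorem invNorm_sq (hZ : Z.PosDef) : invNorm Z u ^ 2 = invForm Z u u :=
  Real.sq_sqrt (invForm_self_nonneg u hZ)

theorem abs_invForm_le (hZ : Z.PosDef) : |invForm Z u v| ≤ invNorm Z u * invNorm Z v := by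
  refine abs_le_of_sq_le_sq ?_ (mul_nonneg (invNorm_nonneg u) (invNorm_nonneg v))
  rw [mul_pow, invNorm_sq u hZ, invNorm_sq v hZ]
  exact invForm_sq_le u v hZ

theorem invNorm_add_le (hZ : Z.PosDef) : invNorm Z (u + v) ≤ invNorm Z u + invNorm Z v := by
  have h0 := add_nonneg (invNorm_nonneg (Z := Z) u) (invNorm_nonneg (Z := Z) v)
  refine Real.sqrt_le_iff.2 ⟨h0, ?_⟩
  have h := (abs_le.1 (abs_invForm_le u v hZ)).2
  rw [invForm_add_left, invForm_add_right, invForm_add_right, invForm_comm v u hZ, add_sq,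
    invNorm_sq u hZ, invNorm_sq v hZ]
  linarith

theorem invNorm_smul (c : ℝ) : invNorm Z (c • u) = |c| * invNorm Z u := by
  rw [invNorm, invForm_smul_left, invForm_smul_right, ← mul_assoc, Real.sqrt_mul (mul_self_nonneg c),
    Real.sqrt_mul_self_eq_abs, invNorm]

theorem invNorm_zero : invNorm Z (0 : Fin d → ℝ) = 0 := by
  rw [invNorm, invForm_zero_right, Real.sqrt_zero]

theorem invNorm_sum_le (hZ : Z.PosDef) {ι : Type*} (s : Finset ι) (f : ι → Fin d → ℝ) :
    invNorm Z (∑ i ∈ s, f i) ≤ ∑ i ∈ s, invNorm Z (f i) := by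
  classical
  induction s using Finset.induction_on with
  | empty => simp [invNorm_zero]
  | insert i s hi ih =>
    rw [Finset.sum_insert hi, Finset.sum_insert hi]
    exact (invNorm_add_le _ _ hZ).trans (by gcongr)

theorem isUnit_det (hZ : Z.PosDef) : IsUnit Z.det := hZ.det_pos.ne'.isUnit

theorem invForm_mulVec_left (hZ : Z.PosDef) : invForm Z (Z *ᵥ u) v = u ⬝ᵥ v := by
  rw [invForm_comm _ _ hZ, invForm, mulVec_mulVec, nonsing_inv_mul _ (isUnit_det hZ), one_mulVec,
    dotProduct_comm]

theorem matNorm_eq_invNorm (hZ : Z.PosDef) (m : Vec d) : matNorm Z m = invNorm Z (Z *ᵥ m.ofLp) := by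
  rw [matNorm, invNorm, invForm_mulVec_left _ _ hZ]

theorem abs_dotProduct_le (hZ : Z.PosDef) (m : Vec d) :
    |m.ofLp ⬝ᵥ v| ≤ matNorm Z m * invNorm Z v := by
  rw [matNorm_eq_invNorm hZ, ← invForm_mulVec_left _ _ hZ]
  exact abs_invForm_le _ _ hZ

theorem posDef_add_vecMulVec (hZ : Z.PosDef) : (Z + vecMulVec u u).PosDef :=
  hZ.add_posSemidef (by simpa using posSemidef_vecMulVec_self_star u)

theorem posDef_smul_one {c : ℝ} (hc : 0 < c) : (c • (1 : Matrix (Fin d) (Fin d) ℝ)).PosDef :=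
  Matrix.PosDef.one.smul hc

/-- The Sherman–Morrison formula. -/
theorem invForm_add_vecMulVec (hZ : Z.PosDef) (x : Fin d → ℝ) :
    invForm (Z + vecMulVec x x) u v
      = invForm Z u v - invForm Z u x * invForm Z x v / (1 + invForm Z x x) := by
  have hx := invForm_self_nonneg x hZ
  have hZ' := posDef_add_vecMulVec x hZ
  set y : Fin d → ℝ := Z⁻¹ *ᵥ v - (invForm Z x v / (1 + invForm Z x x)) • (Z⁻¹ *ᵥ x) with hy
  have key : (Z + vecMulVec x x) *ᵥ y = v := by
    have h1 : ∀ z, Z *ᵥ (Z⁻¹ *ᵥ z) = z := fun z => by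
      rw [mulVec_mulVec, mul_nonsing_inv _ (isUnit_det hZ), one_mulVec]
    have h2 : ∀ z, vecMulVec x x *ᵥ (Z⁻¹ *ᵥ z) = invForm Z x z • x := fun z => by
      rw [vecMulVec_mulVec, invForm]; simp
    rw [hy, mulVec_sub, mulVec_smul, add_mulVec, add_mulVec, h1, h1, h2, h2]
    have h3 : 1 + invForm Z x x ≠ 0 := by positivity
    ext i
    simp only [Pi.sub_apply, Pi.add_apply, Pi.smul_apply, smul_eq_mul]
    field_simp
    ring
  have h4 : (Z + vecMulVec x x)⁻¹ *ᵥ v = y := by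
    conv_lhs => rw [← key]
    rw [mulVec_mulVec, nonsing_inv_mul _ (isUnit_det hZ'), one_mulVec]
  rw [invForm, h4, hy, dotProduct_sub, dotProduct_smul, ← invForm, ← invForm, smul_eq_mul]
  ring

theorem det_add_vecMulVec (hZ : Z.PosDef) (x : Fin d → ℝ) :
    (Z + vecMulVec x x).det = Z.det * (1 + invForm Z x x) := by
  rw [vecMulVec_eq Unit, det_add_replicateCol_mul_replicateRow (isUnit_det hZ)]
  congr 1
  rw [det_unique, Matrix.add_apply, one_apply_eq, Matrix.mul_assoc]
  rfl

/-- One step of the recursion for `‖S‖²_{Z⁻¹}` when `S` is replaced by `S + η x` and `Z` by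
`Z + x xᵀ`. -/
theorem invForm_update_le (hZ : Z.PosDef) (x : Fin d → ℝ) (η : ℝ) :
    invForm (Z + vecMulVec x x) (u + η • x) (u + η • x)
      ≤ invForm Z u u + (η * (2 * invForm Z x u / (1 + invForm Z x x))
        + η ^ 2 * (invForm Z x x / (1 + invForm Z x x))) := by
  have hx := invForm_self_nonneg x hZ
  have h3 : 1 + invForm Z x x ≠ 0 := by positivity
  rw [invForm_add_vecMulVec _ _ hZ]
  simp only [invForm_add_left, invForm_add_right, invForm_smul_left, invForm_smul_right]
  rw [invForm_comm u x hZ]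
  have : 0 ≤ invForm Z x u ^ 2 / (1 + invForm Z x x) := by positivity
  rw [← sub_nonneg]
  refine this.trans (le_of_eq ?_)
  field_simp
  ring

theorem invNorm_le (hZ : Z.PosDef) {c : ℝ} (hc : 0 ≤ c)
    (h : ∀ y, (u ⬝ᵥ y) ^ 2 ≤ c ^ 2 * (y ⬝ᵥ (Z *ᵥ y))) : invNorm Z u ≤ c := by
  have h1 := h (Z⁻¹ *ᵥ u)
  rw [mulVec_mulVec, mul_nonsing_inv _ (isUnit_det hZ), one_mulVec, dotProduct_comm _ u,
    ← invForm] at h1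
  refine Real.sqrt_le_iff.2 ⟨hc, ?_⟩
  by_contra! h2
  nlinarith [sq_nonneg c]

theorem log_det_le (hZ : Z.PosDef) {c lam : ℝ} (hc : 0 < c) (hlam : 0 < lam)
    (h : Z.trace ≤ d * c) : Real.log Z.det - d * Real.log lam ≤ d * Real.log (c / lam) := by
  have h1 : Z.det = ∏ i, hZ.isHermitian.eigenvalues i := by
    simpa using hZ.isHermitian.det_eq_prod_eigenvalues
  have h2 : Z.trace = ∑ i, hZ.isHermitian.eigenvalues i := by
    simpa using hZ.isHermitian.trace_eq_sum_eigenvalues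
  have h3 : ∀ i, Real.log (hZ.isHermitian.eigenvalues i)
      ≤ Real.log c + (hZ.isHermitian.eigenvalues i / c - 1) := fun i => by
    have h4 := hZ.eigenvalues_pos i
    have := Real.log_le_sub_one_of_pos (div_pos h4 hc)
    rw [Real.log_div h4.ne' hc.ne'] at this
    linarith
  rw [h1, Real.log_prod fun i _ => (hZ.eigenvalues_pos i).ne', Real.log_div hc.ne' hlam.ne']
  have h5 := Finset.sum_le_sum fun i (_ : i ∈ Finset.univ) => h3 i
  rw [Finset.sum_add_distrib, Finset.sum_sub_distrib, ← Finset.sum_div, ← h2] at h5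
  simp only [Finset.sum_const, Finset.card_univ, Fintype.card_fin, nsmul_eq_mul, mul_one] at h5
  have h6 : Z.trace / c ≤ d := by rwa [div_le_iff₀ hc]
  linarith

end LinearAlgebra

/-! ### A Bernstein-type exponential supermartingale -/

section Exponential

theorem exp_quadratic_le {lam M β η w p : ℝ} (hlam : 0 ≤ lam) (hM : 0 ≤ M) (hβ : 0 ≤ β)
    (hη : |η| ≤ M) (hp : |p| ≤ w * β) (hb : lam * (M * β + M ^ 2) ≤ 1) :
    Real.exp (lam * (η * (2 * p / (1 + w ^ 2)) + η ^ 2 * (w ^ 2 / (1 + w ^ 2))))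
      ≤ 1 + η * (2 * lam * p / (1 + w ^ 2))
        + η ^ 2 * ((lam + lam ^ 2 * (4 * β ^ 2 + M ^ 2)) * (w ^ 2 / (1 + w ^ 2))) := by
  have hw1 : 0 < 1 + w ^ 2 := by positivity
  set Y := η * (2 * p / (1 + w ^ 2)) + η ^ 2 * (w ^ 2 / (1 + w ^ 2)) with hY
  have hv : w ^ 2 / (1 + w ^ 2) ≤ 1 := by rw [div_le_one hw1]; linarith
  have hη2 : η ^ 2 ≤ M ^ 2 := by rw [← sq_abs]; gcongr
  have h1 : |2 * p / (1 + w ^ 2)| ≤ β := by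
    rw [abs_div, abs_of_pos hw1, div_le_iff₀ hw1, abs_mul, abs_two]
    nlinarith [mul_nonneg hβ (sq_nonneg (w - 1))]
  have hYb : |Y| ≤ M * β + M ^ 2 := by
    refine (abs_add_le _ _).trans (add_le_add ?_ ?_)
    · rw [abs_mul]; gcongr
    · rw [abs_of_nonneg (by positivity)]
      calc η ^ 2 * (w ^ 2 / (1 + w ^ 2)) ≤ M ^ 2 * 1 := by gcongr
        _ = M ^ 2 := mul_one _
  have hx : |lam * Y| ≤ 1 := by
    rw [abs_mul, abs_of_nonneg hlam]
    exact (mul_le_mul_of_nonneg_left hYb hlam).trans hb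
  have h2 := (abs_le.1 (Real.abs_exp_sub_one_sub_id_le hx)).2
  have hY2 : Y ^ 2 ≤ η ^ 2 * ((4 * β ^ 2 + M ^ 2) * (w ^ 2 / (1 + w ^ 2))) := by
    have e : Y = η * ((2 * p + η * w ^ 2) / (1 + w ^ 2)) := by rw [hY]; field_simp
    rw [e, mul_pow]
    refine mul_le_mul_of_nonneg_left ?_ (sq_nonneg _)
    rw [div_pow, div_le_iff₀ (by positivity)]
    have h3 : |2 * p + η * w ^ 2| ≤ w * (2 * β + M * w) := by
      refine (abs_add_le _ _).trans ?_
      rw [abs_mul, abs_mul, abs_two, abs_of_nonneg (sq_nonneg w)]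
      nlinarith [mul_le_mul_of_nonneg_right hη (sq_nonneg w)]
    calc (2 * p + η * w ^ 2) ^ 2 ≤ (w * (2 * β + M * w)) ^ 2 := by
          rw [← sq_abs]; gcongr
      _ ≤ w ^ 2 * ((4 * β ^ 2 + M ^ 2) * (1 + w ^ 2)) := by
          rw [mul_pow]
          refine mul_le_mul_of_nonneg_left ?_ (sq_nonneg w)
          nlinarith [sq_nonneg (2 * β * w - M)]
      _ = _ := by field_simp
  calc Real.exp (lam * Y) ≤ 1 + lam * Y + lam ^ 2 * Y ^ 2 := by linarith [mul_pow lam Y 2]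
    _ ≤ 1 + lam * Y + lam ^ 2 * (η ^ 2 * ((4 * β ^ 2 + M ^ 2) * (w ^ 2 / (1 + w ^ 2)))) := by gcongr
    _ = _ := by rw [hY]; ring

/-- The choice of the exponential tilt. -/
theorem exists_tilt {V l M : ℝ} (hV : 0 ≤ V) (hl : 1 ≤ l) (hM : 0 < M) :
    ∃ lam : ℝ, 0 < lam ∧ lam * (M * (8 * √(V * l) + 4 * M * l) + M ^ 2) ≤ 1 ∧
      (lam + lam ^ 2 * (4 * (8 * √(V * l) + 4 * M * l) ^ 2 + M ^ 2)) * V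
        - lam * (8 * √(V * l) + 4 * M * l) ^ 2 ≤ -l := by
  have hl0 : 0 < l := by linarith
  obtain ⟨s, hs, rfl⟩ : ∃ s : ℝ, 0 ≤ s ∧ V = s ^ 2 * l :=
    ⟨√(V / l), Real.sqrt_nonneg _, by rw [Real.sq_sqrt (by positivity)]; field_simp⟩
  have e : √(s ^ 2 * l * l) = s * l := by
    rw [show s ^ 2 * l * l = (s * l) ^ 2 by ring, Real.sqrt_sq (by positivity)]
  rw [e]
  have hsM : 0 < s + M := by positivity
  have h2sM : 0 < 2 * s + M := by positivity
  refine ⟨1 / (8 * l * (2 * s + M) * (s + M)), by positivity, ?_, ?_⟩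
  · rw [div_mul_eq_mul_div, one_mul, div_le_one (by positivity)]
    nlinarith [mul_nonneg hs hM.le, mul_nonneg hs hs, mul_nonneg (mul_nonneg hs hM.le) hl0.le,
      mul_nonneg (mul_nonneg hs hs) hl0.le, mul_nonneg (sub_nonneg.2 hl) (sq_nonneg M)]
  · have e1 : 8 * (s * l) + 4 * M * l = 4 * l * (2 * s + M) := by ring
    rw [e1]
    set q := s / (s + M) with hq
    set r := s / (2 * s + M) with hr
    have hq0 : 0 ≤ q := by positivity
    have hq1 : q ≤ 1 := by rw [hq, div_le_one hsM]; linarith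
    have hr0 : 0 ≤ r := by positivity
    have hr1 : r ≤ 1 / 2 := by rw [hr, div_le_iff₀ h2sM]; linarith
    have t1 : 1 / (8 * l * (2 * s + M) * (s + M)) * (s ^ 2 * l) = q * r / 8 := by
      rw [hq, hr]; field_simp
    have t2 : (1 / (8 * l * (2 * s + M) * (s + M))) ^ 2 * (4 * (4 * l * (2 * s + M)) ^ 2)
        * (s ^ 2 * l) = l * q ^ 2 := by
      rw [hq]; field_simp; ring
    have t3 : (1 / (8 * l * (2 * s + M) * (s + M))) ^ 2 * M ^ 2 * (s ^ 2 * l)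
        = (1 - q) ^ 2 * r ^ 2 / (64 * l) := by
      have : 1 - q = M / (s + M) := by rw [hq]; field_simp; ring
      rw [this, hr]; field_simp; ring
    have t4 : 1 / (8 * l * (2 * s + M) * (s + M)) * (4 * l * (2 * s + M)) ^ 2
        = 2 * l * (1 + q) := by
      rw [hq]; field_simp; ring
    have b1 : q * r / 8 ≤ l / 16 := by nlinarith
    have b3 : (1 - q) ^ 2 * r ^ 2 / (64 * l) ≤ l / 64 := by
      rw [div_le_iff₀ (by positivity)]
      have : (1 - q) ^ 2 * r ^ 2 ≤ 1 * 1 := by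
        refine mul_le_mul ?_ ?_ (sq_nonneg _) zero_le_one <;> nlinarith
      nlinarith
    have b2 : l * q ^ 2 ≤ l * q := by nlinarith [mul_nonneg hl0.le (mul_nonneg hq0 (sub_nonneg.2 hq1))]
    have hlq : 0 ≤ l * q := by positivity
    calc _ = 1 / (8 * l * (2 * s + M) * (s + M)) * (s ^ 2 * l)
          + (1 / (8 * l * (2 * s + M) * (s + M))) ^ 2 * (4 * (4 * l * (2 * s + M)) ^ 2) * (s ^ 2 * l)
          + (1 / (8 * l * (2 * s + M) * (s + M))) ^ 2 * M ^ 2 * (s ^ 2 * l)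
          - 1 / (8 * l * (2 * s + M) * (s + M)) * (4 * l * (2 * s + M)) ^ 2 := by ring
      _ ≤ -l := by rw [t1, t2, t3, t4]; linarith

variable {Ω : Type*} {m mΩ : MeasurableSpace Ω} {P : Measure Ω} [IsProbabilityMeasure P]

/-- Multiplying by a bounded known factor keeps the mean zero. -/
theorem integral_mul_eq_zero_of_condExp (hm : m ≤ mΩ) {f e : Ω → ℝ} (hf : Measurable[m] f)
    {c : ℝ} (hfc : ∀ᵐ ω ∂P, |f ω| ≤ c) (he : Integrable e P) (h0 : P[e | m] =ᵐ[P] fun _ => 0) :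
    ∫ ω, f ω * e ω ∂P = 0 := by
  have h := condExp_stronglyMeasurable_mul_of_bound hm hf.stronglyMeasurable he c hfc
  rw [show (fun ω => f ω * e ω) = f * e from rfl, ← integral_condExp hm, integral_congr_ae h]
  rw [integral_congr_ae (g := fun _ => (0 : ℝ))]
  · simp
  · filter_upwards [h0] with ω hω
    simp [hω]

theorem integral_mul_le_of_condExp (hm : m ≤ mΩ) {f e g : Ω → ℝ} (hf : Measurable[m] f)
    {c : ℝ} (hfc : ∀ᵐ ω ∂P, |f ω| ≤ c) (hf0 : ∀ᵐ ω ∂P, 0 ≤ f ω) (he : Integrable e P)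
    (h0 : P[e | m] ≤ᵐ[P] g) (hg : Integrable (fun ω => f ω * g ω) P) :
    ∫ ω, f ω * e ω ∂P ≤ ∫ ω, f ω * g ω ∂P := by
  have h := condExp_stronglyMeasurable_mul_of_bound hm hf.stronglyMeasurable he c hfc
  rw [show (fun ω => f ω * e ω) = f * e from rfl, ← integral_condExp hm]
  refine integral_mono_ae integrable_condExp hg ?_
  filter_upwards [h, h0, hf0] with ω h1 h2 h3
  rw [h1]
  exact mul_le_mul_of_nonneg_left h2 h3

/-- One step of the exponential supermartingale. -/
theorem integral_exp_step (hm : m ≤ mΩ) {N g v η : Ω → ℝ} {c κ : ℝ} (hN : Measurable[m] N)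
    (hg : Measurable[m] g) (hv : Measurable[m] v) (hη : Measurable η) (hκ : 0 ≤ κ)
    (hN0 : ∀ ω, 0 ≤ N ω) (hNc : ∀ᵐ ω ∂P, N ω ≤ c) (hgc : ∀ᵐ ω ∂P, |g ω| ≤ c)
    (hv0 : ∀ᵐ ω ∂P, 0 ≤ v ω) (hv1 : ∀ᵐ ω ∂P, v ω ≤ 1) (hηc : ∀ᵐ ω ∂P, |η ω| ≤ c)
    (hmean : P[η | m] =ᵐ[P] fun _ => 0) (hvar : P[fun ω => η ω ^ 2 | m] ≤ᵐ[P] fun _ => 1) :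
    Integrable (fun ω => N ω * Real.exp (-(κ * v ω))
      * (1 + η ω * g ω + η ω ^ 2 * (κ * v ω))) P ∧
    ∫ ω, N ω * Real.exp (-(κ * v ω)) * (1 + η ω * g ω + η ω ^ 2 * (κ * v ω)) ∂P ≤ ∫ ω, N ω ∂P := by
  set N' : Ω → ℝ := fun ω => N ω * Real.exp (-(κ * v ω)) with hN'
  have hN'm : Measurable[m] N' := hN.mul (hv.const_mul κ).neg.exp
  have hN'0 : ∀ ω, 0 ≤ N' ω := fun ω => mul_nonneg (hN0 ω) (Real.exp_pos _).le
  have hN'c : ∀ᵐ ω ∂P, |N' ω| ≤ c := by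
    filter_upwards [hNc, hv0] with ω h1 h2
    rw [abs_of_nonneg (hN'0 ω)]
    refine (mul_le_of_le_one_right (hN0 ω) ?_).trans h1
    exact Real.exp_le_one_iff.2 (neg_nonpos.2 (mul_nonneg hκ h2))
  have hηi : Integrable η P := .of_bound hη.aestronglyMeasurable c hηc
  have hη2i : Integrable (fun ω => η ω ^ 2) P := by
    refine .of_bound (hη.pow_const 2).aestronglyMeasurable (c ^ 2) ?_
    filter_upwards [hηc] with ω h
    rw [Real.norm_eq_abs, abs_pow]
    gcongr
  have hNi : Integrable N P := by
    refine .of_bound (hN.mono hm le_rfl).aestronglyMeasurable c ?_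
    filter_upwards [hNc] with ω h
    rwa [Real.norm_eq_abs, abs_of_nonneg (hN0 ω)]
  have hN'i : Integrable N' P := .of_bound (hN'm.mono hm le_rfl).aestronglyMeasurable c hN'c
  have hb1 : ∀ᵐ ω ∂P, |N' ω * g ω| ≤ c * c := by
    filter_upwards [hN'c, hgc] with ω h1 h2
    rw [abs_mul]
    exact mul_le_mul h1 h2 (abs_nonneg _) ((abs_nonneg _).trans h1)
  have hb2 : ∀ᵐ ω ∂P, |N' ω * (κ * v ω)| ≤ c * κ := by
    filter_upwards [hN'c, hv0, hv1] with ω h1 h2 h3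
    rw [abs_mul, abs_of_nonneg (mul_nonneg hκ h2)]
    exact mul_le_mul h1 (mul_le_of_le_one_right hκ h3) (mul_nonneg hκ h2) ((abs_nonneg _).trans h1)
  have hm1 : Measurable[m] fun ω => N' ω * g ω := hN'm.mul hg
  have hm2 : Measurable[m] fun ω => N' ω * (κ * v ω) := hN'm.mul (hv.const_mul κ)
  have hi1 : Integrable (fun ω => N' ω * g ω * η ω) P :=
    hηi.bdd_mul (hm1.mono hm le_rfl).aestronglyMeasurable hb1
  have hi2 : Integrable (fun ω => N' ω * (κ * v ω) * η ω ^ 2) P :=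
    hη2i.bdd_mul (hm2.mono hm le_rfl).aestronglyMeasurable hb2
  have hi3 : Integrable (fun ω => N' ω * (κ * v ω) * 1) P := by
    simpa using Integrable.of_bound (hm2.mono hm le_rfl).aestronglyMeasurable (c * κ) hb2
  have h1 := integral_mul_eq_zero_of_condExp hm hm1 hb1 hηi hmean
  have h2 := integral_mul_le_of_condExp hm hm2 hb2
    (by filter_upwards [hv0] with ω h; exact mul_nonneg (hN'0 ω) (mul_nonneg hκ h)) hη2i hvar hi3
  have e : (fun ω => N' ω * (1 + η ω * g ω + η ω ^ 2 * (κ * v ω)))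
      = fun ω => N' ω + N' ω * g ω * η ω + N' ω * (κ * v ω) * η ω ^ 2 := by
    ext ω; ring
  refine ⟨e ▸ (hN'i.add hi1).add hi2, ?_⟩
  calc ∫ ω, N' ω * (1 + η ω * g ω + η ω ^ 2 * (κ * v ω)) ∂P
      = ∫ ω, (N' ω + N' ω * g ω * η ω + N' ω * (κ * v ω) * η ω ^ 2) ∂P := by rw [e]
    _ = ∫ ω, N' ω ∂P + ∫ ω, N' ω * g ω * η ω ∂P + ∫ ω, N' ω * (κ * v ω) * η ω ^ 2 ∂P := by
        rw [← integral_add hN'i hi1]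
        exact integral_add (hN'i.add hi1) hi2
    _ ≤ ∫ ω, N' ω ∂P + ∫ ω, N' ω * (κ * v ω) * 1 ∂P := by rw [h1]; linarith
    _ = ∫ ω, (N' ω + N' ω * (κ * v ω) * 1) ∂P := (integral_add hN'i hi3).symm
    _ ≤ ∫ ω, N ω ∂P := by
        refine integral_mono (hN'i.add hi3) hNi fun ω => ?_
        calc N' ω + N' ω * (κ * v ω) * 1 = N ω * (Real.exp (-(κ * v ω)) * (κ * v ω + 1)) := by
              rw [hN']; ring
          _ ≤ N ω * (Real.exp (-(κ * v ω)) * Real.exp (κ * v ω)) := by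
              gcongr
              · exact hN0 ω
              · exact Real.add_one_le_exp _
          _ = N ω := by rw [← Real.exp_add]; simp

/-- The exponential supermartingale: the `Y t` are increments whose exponential is dominated by
`1 + η g + η² κ v` with `g`, `v` known and `η` a centred noise of conditional variance at most `1`. -/
theorem integral_exp_sum_le_one (ℱ : Filtration ℕ mΩ) {T : ℕ} {η g v Y : ℕ → Ω → ℝ} {c b κ : ℝ}
    (hκ : 0 ≤ κ) (hη : ∀ t ∈ Finset.Icc 1 T, Measurable[ℱ (t + 1)] (η t))
    (hY : ∀ t ∈ Finset.Icc 1 T, Measurable[ℱ (t + 1)] (Y t))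
    (hg : ∀ t ∈ Finset.Icc 1 T, Measurable[ℱ t] (g t))
    (hv : ∀ t ∈ Finset.Icc 1 T, Measurable[ℱ t] (v t))
    (hηc : ∀ t ∈ Finset.Icc 1 T, ∀ᵐ ω ∂P, |η t ω| ≤ c)
    (hgc : ∀ t ∈ Finset.Icc 1 T, ∀ᵐ ω ∂P, |g t ω| ≤ c)
    (hv0 : ∀ t ∈ Finset.Icc 1 T, ∀ᵐ ω ∂P, 0 ≤ v t ω)
    (hv1 : ∀ t ∈ Finset.Icc 1 T, ∀ᵐ ω ∂P, v t ω ≤ 1)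
    (hYb : ∀ t ∈ Finset.Icc 1 T, ∀ᵐ ω ∂P, Y t ω ≤ b)
    (hexp : ∀ t ∈ Finset.Icc 1 T, ∀ᵐ ω ∂P,
      Real.exp (Y t ω) ≤ 1 + η t ω * g t ω + η t ω ^ 2 * (κ * v t ω))
    (hmean : ∀ t ∈ Finset.Icc 1 T, P[η t | ℱ t] =ᵐ[P] fun _ => 0)
    (hvar : ∀ t ∈ Finset.Icc 1 T, P[fun ω => η t ω ^ 2 | ℱ t] ≤ᵐ[P] fun _ => 1)
    (t : ℕ) (ht : t ≤ T) :
    Integrable (fun ω => Real.exp (∑ i ∈ Finset.Icc 1 t, (Y i ω - κ * v i ω))) P ∧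
    ∫ ω, Real.exp (∑ i ∈ Finset.Icc 1 t, (Y i ω - κ * v i ω)) ∂P ≤ 1 := by
  have hmeas : ∀ t ≤ T, Measurable[ℱ (t + 1)]
      fun ω => Real.exp (∑ i ∈ Finset.Icc 1 t, (Y i ω - κ * v i ω)) := by
    intro t ht
    refine Measurable.exp (Finset.measurable_fun_sum _ fun i hi => ?_)
    obtain ⟨hi1, hi2⟩ := Finset.mem_Icc.1 hi
    have hiT : i ∈ Finset.Icc 1 T := Finset.mem_Icc.2 ⟨hi1, hi2.trans ht⟩
    exact ((hY i hiT).mono (ℱ.mono (by omega)) le_rfl).sub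
      (((hv i hiT).mono (ℱ.mono (by omega)) le_rfl).const_mul κ)
  have hbdd : ∀ t ≤ T, ∀ᵐ ω ∂P,
      Real.exp (∑ i ∈ Finset.Icc 1 t, (Y i ω - κ * v i ω)) ≤ Real.exp (t * |b|) := by
    intro t ht
    have : ∀ᵐ ω ∂P, ∀ i ∈ Finset.Icc 1 T, Y i ω ≤ b ∧ 0 ≤ v i ω := by
      rw [Finset.eventually_all]
      exact fun i hi => (hYb i hi).and (hv0 i hi)
    filter_upwards [this] with ω h
    refine Real.exp_le_exp.2 ((Finset.sum_le_card_nsmul _ _ |b| fun i hi => ?_).trans ?_)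
    · obtain ⟨hi1, hi2⟩ := Finset.mem_Icc.1 hi
      obtain ⟨h1, h2⟩ := h i (Finset.mem_Icc.2 ⟨hi1, hi2.trans ht⟩)
      linarith [le_abs_self b, mul_nonneg hκ h2]
    · simp
  have hint : ∀ t ≤ T,
      Integrable (fun ω => Real.exp (∑ i ∈ Finset.Icc 1 t, (Y i ω - κ * v i ω))) P := by
    intro t ht
    refine .of_bound ((hmeas t ht).mono (ℱ.le _) le_rfl).aestronglyMeasurable (Real.exp (t * |b|)) ?_
    filter_upwards [hbdd t ht] with ω h
    rwa [Real.norm_eq_abs, abs_of_pos (Real.exp_pos _)]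
  refine ⟨hint t ht, ?_⟩
  induction t with
  | zero => simp
  | succ t ih =>
    have hT : t + 1 ∈ Finset.Icc 1 T := Finset.mem_Icc.2 ⟨by omega, ht⟩
    refine le_trans ?_ (ih (by omega))
    set N : Ω → ℝ := fun ω => Real.exp (∑ i ∈ Finset.Icc 1 t, (Y i ω - κ * v i ω)) with hN
    have hc0 : (0 : ℝ) ≤ c := by
      obtain ⟨ω, h⟩ := (hηc _ hT).exists
      exact (abs_nonneg _).trans h
    have step := integral_exp_step (P := P) (m := ℱ (t + 1)) (ℱ.le _) (N := N) (g := g (t + 1))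
      (v := v (t + 1)) (η := η (t + 1)) (c := Real.exp (t * |b|) + c) (κ := κ)
      (hmeas t (by omega)) (hg _ hT) (hv _ hT) ((hη _ hT).mono (ℱ.le _) le_rfl) hκ
      (fun ω => (Real.exp_pos _).le)
      (by filter_upwards [hbdd t (by omega)] with ω h; linarith)
      (by filter_upwards [hgc _ hT] with ω h; linarith [Real.exp_pos (t * |b|)])
      (hv0 _ hT) (hv1 _ hT)
      (by filter_upwards [hηc _ hT] with ω h; linarith [Real.exp_pos (t * |b|)])
      (hmean _ hT) (hvar _ hT)
    refine le_trans (integral_mono_of_nonneg (ae_of_all _ fun ω => (Real.exp_pos _).le) step.1 ?_) step.2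
    · filter_upwards [hexp _ hT] with ω h
      rw [Finset.sum_Icc_succ_top (by omega), Real.exp_add, sub_eq_add_neg, Real.exp_add,
        mul_comm (Real.exp (Y _ _)), ← mul_assoc]
      exact mul_le_mul_of_nonneg_left h (mul_pos (Real.exp_pos _) (Real.exp_pos _)).le

end Exponential

/-! ### The weighted design along one trajectory -/

section Trajectory

variable {d : ℕ}

/-- The weighted action `a_i / σ̄_i`. -/
noncomputable def wAct (R : ℝ) (a : ℕ → Vec d) (s : ℕ → ℝ) (i : ℕ) : Fin d → ℝ :=
  (sdBar d R (s i))⁻¹ • (a i).ofLp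

/-- The weighted noise `ε_i / σ̄_i`. -/
noncomputable def wNoise (d : ℕ) (R : ℝ) (s e : ℕ → ℝ) (i : ℕ) : ℝ := (sdBar d R (s i))⁻¹ * e i

/-- The noise part `∑_{i < t} ε_i a_i / σ̄_i²` of `b_t`. -/
noncomputable def noiseSum (R : ℝ) (a : ℕ → Vec d) (s e : ℕ → ℝ) (t : ℕ) : Fin d → ℝ :=
  ∑ i ∈ Finset.Ico 1 t, wNoise d R s e i • wAct R a s i

/-- The squared norm `‖a_t / σ̄_t‖²` in `Σ_t⁻¹`. -/
noncomputable def wSq (lam R : ℝ) (a : ℕ → Vec d) (s : ℕ → ℝ) (t : ℕ) : ℝ :=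
  invForm (gram lam R a s t) (wAct R a s t) (wAct R a s t)

/-- The leverage `w² / (1 + w²)` of the weighted action of round `t`. -/
noncomputable def leverage (lam R : ℝ) (a : ℕ → Vec d) (s : ℕ → ℝ) (t : ℕ) : ℝ :=
  wSq lam R a s t / (1 + wSq lam R a s t)

/-- The squared self-normalized noise. -/
noncomputable def noiseSq (lam R : ℝ) (a : ℕ → Vec d) (s e : ℕ → ℝ) (t : ℕ) : ℝ :=
  invForm (gram lam R a s t) (noiseSum R a s e t) (noiseSum R a s e t)

/-- The cross term between the weighted action and the noise sum, set to `0` once the noise sum is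
larger than `β`. -/
noncomputable def crossTerm (lam R β : ℝ) (a : ℕ → Vec d) (s e : ℕ → ℝ) (t : ℕ) : ℝ :=
  if noiseSq lam R a s e t ≤ β ^ 2 then
    invForm (gram lam R a s t) (wAct R a s t) (noiseSum R a s e t) else 0

/-- The increment that dominates `noiseSq (t + 1) - noiseSq t`. -/
noncomputable def noiseIncr (lam R β : ℝ) (a : ℕ → Vec d) (s e : ℕ → ℝ) (t : ℕ) : ℝ :=
  wNoise d R s e t * (2 * crossTerm lam R β a s e t / (1 + wSq lam R a s t))
    + wNoise d R s e t ^ 2 * leverage lam R a s t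

/-- The logarithmic factor in the confidence radius. -/
noncomputable def logRatio (lam A R : ℝ) (t : ℕ) : ℝ :=
  Real.log (((R + 1) ^ 2 * lam + t * A ^ 2) / ((R + 1) ^ 2 * lam))

/-- The part of the confidence radius that accounts for the noise. -/
noncomputable def noiseRadius (d : ℕ) (lam A R δ : ℝ) (t : ℕ) : ℝ :=
  8 * √(d * logRatio lam A R t * Real.log (4 * t ^ 2 / δ)) + 4 * √(d : ℝ) * Real.log (4 * t ^ 2 / δ)

theorem sdBar_pos (hd : 0 < d) {R : ℝ} (hR : 0 ≤ R) (s : ℝ) : 0 < sdBar d R s :=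
  lt_max_of_lt_left (by positivity)

theorem inv_sdBar_le (hd : 0 < d) {R : ℝ} (hR : 0 ≤ R) (s : ℝ) :
    (sdBar d R s)⁻¹ ≤ √(d : ℝ) / (R + 1) := by
  rw [inv_le_comm₀ (sdBar_pos hd hR s) (by positivity), inv_div]
  exact le_max_left _ _

theorem vecMulVec_wAct (R : ℝ) (a : ℕ → Vec d) (s : ℕ → ℝ) (i : ℕ) :
    vecMulVec (wAct R a s i) (wAct R a s i)
      = (sdBar d R (s i) ^ 2)⁻¹ • vecMulVec (a i).ofLp (a i).ofLp := by
  rw [wAct, smul_vecMulVec, vecMulVec_smul, smul_smul, ← sq, inv_pow]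

theorem gram_posDef {lam : ℝ} (hlam : 0 < lam) (R : ℝ) (a : ℕ → Vec d) (s : ℕ → ℝ) (t : ℕ) :
    (gram lam R a s t).PosDef := by
  refine (posDef_smul_one hlam).add_posSemidef (posSemidef_sum _ fun i _ => ?_)
  rw [← vecMulVec_wAct]
  simpa using posSemidef_vecMulVec_self_star (wAct R a s i)

theorem gram_succ_eq (lam R : ℝ) (a : ℕ → Vec d) (s : ℕ → ℝ) {t : ℕ} (ht : 1 ≤ t) :
    gram lam R a s (t + 1) = gram lam R a s t + vecMulVec (wAct R a s t) (wAct R a s t) := by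
  rw [gram_succ _ _ _ _ _ ht, vecMulVec_wAct]

theorem noiseSum_succ (R : ℝ) (a : ℕ → Vec d) (s e : ℕ → ℝ) {t : ℕ} (ht : 1 ≤ t) :
    noiseSum R a s e (t + 1) = noiseSum R a s e t + wNoise d R s e t • wAct R a s t := by
  rw [noiseSum, Finset.sum_Ico_succ_top ht, noiseSum]

theorem wSq_nonneg {lam : ℝ} (hlam : 0 < lam) (R : ℝ) (a : ℕ → Vec d) (s : ℕ → ℝ) (t : ℕ) :
    0 ≤ wSq lam R a s t := invForm_self_nonneg _ (gram_posDef hlam R a s t)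

theorem leverage_nonneg {lam : ℝ} (hlam : 0 < lam) (R : ℝ) (a : ℕ → Vec d) (s : ℕ → ℝ) (t : ℕ) :
    0 ≤ leverage lam R a s t := by
  have := wSq_nonneg hlam R a s t
  unfold leverage
  positivity

theorem leverage_le_one {lam : ℝ} (hlam : 0 < lam) (R : ℝ) (a : ℕ → Vec d) (s : ℕ → ℝ) (t : ℕ) :
    leverage lam R a s t ≤ 1 := by
  have := wSq_nonneg hlam R a s t
  rw [leverage, div_le_one (by positivity)]
  linarith

theorem noiseSq_succ_le {lam : ℝ} (hlam : 0 < lam) (R β : ℝ) (a : ℕ → Vec d) (s e : ℕ → ℝ) {t : ℕ}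
    (ht : 1 ≤ t) (h : noiseSq lam R a s e t ≤ β ^ 2) :
    noiseSq lam R a s e (t + 1) ≤ noiseSq lam R a s e t + noiseIncr lam R β a s e t := by
  have := invForm_update_le (noiseSum R a s e t) (gram_posDef hlam R a s t) (wAct R a s t)
    (wNoise d R s e t)
  rw [← gram_succ_eq _ _ _ _ ht, ← noiseSum_succ _ _ _ _ ht] at this
  rw [noiseIncr, crossTerm, if_pos h]
  exact this

/-- As long as the noise sum has not exceeded `β`, it is dominated by the sum of the increments. -/
theorem noiseSq_le_sum {lam : ℝ} (hlam : 0 < lam) (R β : ℝ) (a : ℕ → Vec d) (s e : ℕ → ℝ) (n : ℕ)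
    (h : ∀ j ∈ Finset.Icc 1 n, noiseSq lam R a s e j ≤ β ^ 2) :
    noiseSq lam R a s e (n + 1) ≤ ∑ i ∈ Finset.Icc 1 n, noiseIncr lam R β a s e i := by
  induction n with
  | zero => simp [noiseSq, noiseSum, invForm_zero_right]
  | succ n ih =>
    rw [Finset.sum_Icc_succ_top (by omega)]
    refine (noiseSq_succ_le hlam R β a s e (by omega) (h _ (by simp))).trans ?_
    have := ih fun j hj => h j (by simp at hj ⊢; omega)
    linarith

theorem abs_crossTerm_le {lam : ℝ} (hlam : 0 < lam) (R : ℝ) {β : ℝ} (hβ : 0 ≤ β) (a : ℕ → Vec d)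
    (s e : ℕ → ℝ) (t : ℕ) : |crossTerm lam R β a s e t| ≤ √(wSq lam R a s t) * β := by
  rw [crossTerm]
  split_ifs with h
  · refine (abs_invForm_le _ _ (gram_posDef hlam R a s t)).trans ?_
    exact mul_le_mul_of_nonneg_left (Real.sqrt_le_iff.2 ⟨hβ, h⟩) (Real.sqrt_nonneg _)
  · rw [abs_zero]
    positivity

theorem sum_leverage_le_log_det {lam : ℝ} (hlam : 0 < lam) (R : ℝ) (a : ℕ → Vec d) (s : ℕ → ℝ)
    (n : ℕ) : ∑ i ∈ Finset.Icc 1 n, leverage lam R a s i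
      ≤ Real.log (gram lam R a s (n + 1)).det - d * Real.log lam := by
  induction n with
  | zero => simp [gram_one]
  | succ n ih =>
    have h0 := wSq_nonneg hlam R a s (n + 1)
    have h1 : 0 < 1 + wSq lam R a s (n + 1) := by positivity
    have h2 : leverage lam R a s (n + 1) ≤ Real.log (1 + wSq lam R a s (n + 1)) := by
      refine le_trans (le_of_eq ?_) (Real.one_sub_inv_le_log_of_pos h1)
      rw [leverage]
      field_simp
      ring
    rw [Finset.sum_Icc_succ_top (by omega), gram_succ_eq _ _ _ _ (show 1 ≤ n + 1 by omega),
      det_add_vecMulVec (gram_posDef hlam R a s _), ← wSq,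
      Real.log_mul (gram_posDef hlam R a s _).det_pos.ne' h1.ne']
    linarith

theorem trace_gram_le (hd : 0 < d) {R : ℝ} (hR : 0 ≤ R) (lam : ℝ) {A : ℝ} (a : ℕ → Vec d)
    (s : ℕ → ℝ) (n : ℕ) (ha : ∀ i ∈ Finset.Icc 1 n, ‖a i‖ ≤ A) :
    (gram lam R a s (n + 1)).trace ≤ d * (lam + n * (A ^ 2 / (R + 1) ^ 2)) := by
  induction n with
  | zero => simp [gram_one, trace_smul, mul_comm]
  | succ n ih =>
    have h1 := ih fun i hi => ha i (by simp at hi ⊢; omega)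
    have h2 := ha (n + 1) (by simp)
    have h3 : (vecMulVec (wAct R a s (n + 1)) (wAct R a s (n + 1))).trace
        ≤ d * (A ^ 2 / (R + 1) ^ 2) := by
      have e : (a (n + 1)).ofLp ⬝ᵥ (a (n + 1)).ofLp = ‖a (n + 1)‖ ^ 2 := by
        rw [EuclideanSpace.norm_sq_eq]
        simp [dotProduct, sq]
      rw [trace_vecMulVec, wAct, smul_dotProduct, dotProduct_smul, e, smul_eq_mul, smul_eq_mul,
        ← mul_assoc, ← sq]
      calc (sdBar d R (s (n + 1)))⁻¹ ^ 2 * ‖a (n + 1)‖ ^ 2 ≤ (√(d : ℝ) / (R + 1)) ^ 2 * A ^ 2 := by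
            have := sdBar_pos hd hR (s (n + 1))
            gcongr
            exact inv_sdBar_le hd hR _
        _ = _ := by rw [div_pow, Real.sq_sqrt (by positivity)]; ring
    rw [gram_succ_eq _ _ _ _ (show 1 ≤ n + 1 by omega), trace_add]
    push_cast
    linarith

theorem logRatio_mono {lam : ℝ} (hlam : 0 < lam) (A : ℝ) {R : ℝ} (hR : 0 ≤ R) {n t : ℕ}
    (hnt : n ≤ t) : logRatio lam A R n ≤ logRatio lam A R t := by
  unfold logRatio
  have : (n : ℝ) ≤ t := by exact_mod_cast hnt
  gcongr

theorem logRatio_nonneg {lam : ℝ} (hlam : 0 < lam) (A : ℝ) {R : ℝ} (hR : 0 ≤ R) (t : ℕ) :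
    0 ≤ logRatio lam A R t := by
  refine Real.log_nonneg ?_
  rw [one_le_div (by positivity)]
  have : (0 : ℝ) ≤ t * A ^ 2 := by positivity
  linarith

/-- The elliptical potential bound. -/
theorem sum_leverage_le (hd : 0 < d) {lam : ℝ} (hlam : 0 < lam) {R : ℝ} (hR : 0 ≤ R) {A : ℝ}
    (a : ℕ → Vec d) (s : ℕ → ℝ) (n : ℕ) (ha : ∀ i ∈ Finset.Icc 1 n, ‖a i‖ ≤ A) :
    ∑ i ∈ Finset.Icc 1 n, leverage lam R a s i ≤ d * logRatio lam A R n := by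
  refine (sum_leverage_le_log_det hlam R a s n).trans ?_
  have h := log_det_le (gram_posDef hlam R a s (n + 1)) (c := lam + n * (A ^ 2 / (R + 1) ^ 2))
    (by positivity) hlam (trace_gram_le hd hR lam a s n ha)
  refine h.trans (le_of_eq ?_)
  rw [logRatio]
  congr 2
  field_simp

theorem one_le_log_radius {δ : ℝ} (hδ : 0 < δ) (hδ1 : δ < 1) {t : ℕ} (ht : 1 ≤ t) :
    1 ≤ Real.log (4 * t ^ 2 / δ) := by
  have ht' : (1 : ℝ) ≤ t := by exact_mod_cast ht
  rw [Real.le_log_iff_exp_le (by positivity), le_div_iff₀ hδ]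
  have := Real.exp_one_lt_d9
  have := Real.exp_pos 1
  nlinarith

theorem noiseRadius_nonneg (d : ℕ) (lam A R : ℝ) {δ : ℝ} (hδ : 0 < δ) (hδ1 : δ < 1) {t : ℕ}
    (ht : 1 ≤ t) : 0 ≤ noiseRadius d lam A R δ t := by
  have := one_le_log_radius hδ hδ1 ht
  unfold noiseRadius
  positivity

theorem noiseRadius_mono (d : ℕ) {lam : ℝ} (hlam : 0 < lam) (A : ℝ) {R : ℝ} (hR : 0 ≤ R) {δ : ℝ}
    (hδ : 0 < δ) (hδ1 : δ < 1) {n t : ℕ} (hn : 1 ≤ n) (hnt : n ≤ t) :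
    noiseRadius d lam A R δ n ≤ noiseRadius d lam A R δ t := by
  have h1 := one_le_log_radius hδ hδ1 hn
  have h2 := logRatio_mono hlam A hR hnt
  have h3 := logRatio_nonneg hlam A hR n
  have h4 := logRatio_nonneg hlam A hR t
  have h5 : (n : ℝ) ≤ t := by exact_mod_cast hnt
  have h6 : (0 : ℝ) < n := by exact_mod_cast hn
  unfold noiseRadius
  gcongr

end Trajectory

/-! ### Measurability -/

section Measurability

variable {d : ℕ} {Ω : Type*} {m : MeasurableSpace Ω}

theorem measurable_invForm {Z : Ω → Matrix (Fin d) (Fin d) ℝ} {u v : Ω → Fin d → ℝ}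
    (hZ : ∀ i j, Measurable fun ω => Z ω i j) (hu : ∀ i, Measurable fun ω => u ω i)
    (hv : ∀ i, Measurable fun ω => v ω i) : Measurable fun ω => invForm (Z ω) (u ω) (v ω) := by
  have hdet : Measurable fun ω => (Z ω).det := by
    simp only [det_apply]
    exact Finset.measurable_fun_sum _ fun σ _ =>
      (Finset.measurable_fun_prod _ fun i _ => hZ _ _).const_smul _
  have hadj : ∀ i j, Measurable fun ω => (Z ω).adjugate i j := by
    intro i j
    simp only [adjugate_apply, det_apply]
    refine Finset.measurable_fun_sum _ fun σ _ =>
      (Finset.measurable_fun_prod _ fun k _ => ?_).const_smul _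
    by_cases h : σ k = j
    · simp [updateRow_apply, h]
    · simpa [updateRow_apply, h] using hZ _ _
  simp only [invForm, inv_def, Ring.inverse_eq_inv', dotProduct, mulVec, Matrix.smul_apply,
    smul_eq_mul]
  exact Finset.measurable_fun_sum _ fun i _ => (hu i).mul <| Finset.measurable_fun_sum _ fun j _ =>
    (hdet.inv.mul (hadj i j)).mul (hv j)

variable {a : ℕ → Ω → Vec d} {s e : ℕ → Ω → ℝ}

theorem measurable_sdBar {s : Ω → ℝ} (hs : Measurable s) (d : ℕ) (R : ℝ) :
    Measurable fun ω => sdBar d R (s ω) := measurable_const.max hs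

theorem measurable_apply {a : Ω → Vec d} (ha : Measurable a) (j : Fin d) :
    Measurable fun ω => (a ω).ofLp j :=
  (EuclideanSpace.proj (𝕜 := ℝ) j).continuous.measurable.comp ha

theorem measurable_wAct (R : ℝ) {i : ℕ} (ha : Measurable (a i)) (hs : Measurable (s i))
    (j : Fin d) : Measurable fun ω => wAct R (fun i => a i ω) (fun i => s i ω) i j := by
  simp only [wAct, Pi.smul_apply, smul_eq_mul]
  exact (measurable_sdBar hs d R).inv.mul (measurable_apply ha j)

theorem measurable_wNoise (d : ℕ) (R : ℝ) {i : ℕ} (hs : Measurable (s i)) (he : Measurable (e i)) :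
    Measurable fun ω => wNoise d R (fun i => s i ω) (fun i => e i ω) i :=
  (measurable_sdBar hs d R).inv.mul he

theorem measurable_gram (lam R : ℝ) {t : ℕ} (ha : ∀ i ∈ Finset.Ico 1 t, Measurable (a i))
    (hs : ∀ i ∈ Finset.Ico 1 t, Measurable (s i)) (j k : Fin d) :
    Measurable fun ω => gram lam R (fun i => a i ω) (fun i => s i ω) t j k := by
  simp only [CorruptedBandit.gram, Matrix.add_apply, Matrix.sum_apply, Matrix.smul_apply,
    vecMulVec_apply, smul_eq_mul]
  exact measurable_const.add (Finset.measurable_fun_sum _ fun i hi =>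
    ((measurable_sdBar (hs i hi) d R).pow_const 2).inv.mul
      ((measurable_apply (ha i hi) j).mul (measurable_apply (ha i hi) k)))

theorem measurable_noiseSum (R : ℝ) {t : ℕ} (ha : ∀ i ∈ Finset.Ico 1 t, Measurable (a i))
    (hs : ∀ i ∈ Finset.Ico 1 t, Measurable (s i)) (he : ∀ i ∈ Finset.Ico 1 t, Measurable (e i))
    (j : Fin d) :
    Measurable fun ω => noiseSum R (fun i => a i ω) (fun i => s i ω) (fun i => e i ω) t j := by
  simp only [noiseSum, Finset.sum_apply, Pi.smul_apply, smul_eq_mul]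
  exact Finset.measurable_fun_sum _ fun i hi =>
    (measurable_wNoise d R (hs i hi) (he i hi)).mul (measurable_wAct R (ha i hi) (hs i hi) j)

theorem measurable_wSq (lam R : ℝ) {t : ℕ} (ha : ∀ i ∈ Finset.Icc 1 t, Measurable (a i))
    (hs : ∀ i ∈ Finset.Icc 1 t, Measurable (s i)) (ht : 1 ≤ t) :
    Measurable fun ω => wSq lam R (fun i => a i ω) (fun i => s i ω) t := by
  have ht' : t ∈ Finset.Icc 1 t := Finset.mem_Icc.2 ⟨ht, le_rfl⟩
  have hw := measurable_wAct R (ha t ht') (hs t ht')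
  exact measurable_invForm (measurable_gram lam R (fun i hi => ha i (Finset.Ico_subset_Icc_self hi))
    fun i hi => hs i (Finset.Ico_subset_Icc_self hi)) hw hw

theorem measurable_leverage (lam R : ℝ) {t : ℕ} (ha : ∀ i ∈ Finset.Icc 1 t, Measurable (a i))
    (hs : ∀ i ∈ Finset.Icc 1 t, Measurable (s i)) (ht : 1 ≤ t) :
    Measurable fun ω => leverage lam R (fun i => a i ω) (fun i => s i ω) t :=
  have h := measurable_wSq lam R ha hs ht
  h.div (h.const_add 1)

theorem measurable_crossTerm (lam R β : ℝ) {t : ℕ} (ha : ∀ i ∈ Finset.Icc 1 t, Measurable (a i))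
    (hs : ∀ i ∈ Finset.Icc 1 t, Measurable (s i)) (he : ∀ i ∈ Finset.Ico 1 t, Measurable (e i))
    (ht : 1 ≤ t) : Measurable fun ω =>
      crossTerm lam R β (fun i => a i ω) (fun i => s i ω) (fun i => e i ω) t := by
  have ht' : t ∈ Finset.Icc 1 t := Finset.mem_Icc.2 ⟨ht, le_rfl⟩
  have ha' : ∀ i ∈ Finset.Ico 1 t, Measurable (a i) :=
    fun i hi => ha i (Finset.Ico_subset_Icc_self hi)
  have hs' : ∀ i ∈ Finset.Ico 1 t, Measurable (s i) :=
    fun i hi => hs i (Finset.Ico_subset_Icc_self hi)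
  have hw := measurable_wAct R (ha t ht') (hs t ht')
  have hg := measurable_gram lam R ha' hs'
  have hn := measurable_noiseSum R ha' hs' he
  exact Measurable.ite (measurableSet_le (measurable_invForm hg hn hn) measurable_const)
    (measurable_invForm hg hw hn) measurable_const

end Measurability

/-! ### The self-normalized Bernstein inequality -/

section Concentration

variable {d : ℕ} {Ω : Type*} {mΩ : MeasurableSpace Ω} {P : Measure Ω}

/-- Adapted actions, standard deviation bounds and centred noises. -/
structure IsNoiseModel (ℱ : Filtration ℕ mΩ) (P : Measure Ω) (T : ℕ) (A R : ℝ)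
    (a : ℕ → Ω → Vec d) (s e : ℕ → Ω → ℝ) : Prop where
  meas_act : ∀ t ∈ Finset.Icc 1 T, Measurable[ℱ t] (a t)
  meas_sd : ∀ t ∈ Finset.Icc 1 T, Measurable[ℱ t] (s t)
  meas_noise : ∀ t ∈ Finset.Icc 1 T, Measurable[ℱ (t + 1)] (e t)
  norm_act : ∀ t ∈ Finset.Icc 1 T, ∀ᵐ ω ∂P, ‖a t ω‖ ≤ A
  sd_nonneg : ∀ t ∈ Finset.Icc 1 T, ∀ᵐ ω ∂P, 0 ≤ s t ω
  abs_noise : ∀ t ∈ Finset.Icc 1 T, ∀ᵐ ω ∂P, |e t ω| ≤ R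
  mean : ∀ t ∈ Finset.Icc 1 T, P[e t | ℱ t] =ᵐ[P] fun _ => 0
  var : ∀ t ∈ Finset.Icc 1 T, P[fun ω => e t ω ^ 2 | ℱ t] ≤ᵐ[P] fun ω => s t ω ^ 2

variable {ℱ : Filtration ℕ mΩ} {T : ℕ} {A R : ℝ} {a : ℕ → Ω → Vec d} {s e : ℕ → Ω → ℝ}

theorem abs_wNoise_le (hd : 0 < d) (hR : 0 ≤ R) {s e : ℕ → ℝ} {i : ℕ} (he : |e i| ≤ R) :
    |wNoise d R s e i| ≤ √(d : ℝ) := by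
  rw [wNoise, abs_mul, abs_of_pos (inv_pos.2 (sdBar_pos hd hR _))]
  calc (sdBar d R (s i))⁻¹ * |e i| ≤ √(d : ℝ) / (R + 1) * (R + 1) := by
        gcongr
        · exact inv_sdBar_le hd hR _
        · linarith
    _ = √(d : ℝ) := by field_simp

theorem sum_inv_sq_le (T : ℕ) :
    ∑ n ∈ Finset.range T, 1 / (4 * (n + 1 : ℝ) ^ 2) ≤ 1 - 1 / (T + 1 : ℝ) := by
  induction T with
  | zero => simp
  | succ n ih =>
    rw [Finset.sum_range_succ]
    push_cast
    have h1 : (1 : ℝ) / (4 * (n + 1) ^ 2) ≤ 1 / (n + 1) - 1 / (n + 1 + 1) := by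
      have hn : (0 : ℝ) ≤ n := n.cast_nonneg
      rw [div_sub_div _ _ (by positivity) (by positivity), div_le_div_iff₀ (by positivity)
        (by positivity)]
      nlinarith
    linarith

namespace IsNoiseModel

theorem measurable_act (h : IsNoiseModel ℱ P T A R a s e)
    {i t : ℕ} (hi : i ∈ Finset.Icc 1 t) (ht : t ≤ T) :
    Measurable[ℱ t] (a i) := by
  obtain ⟨h1, h2⟩ := Finset.mem_Icc.1 hi
  exact (h.meas_act i (Finset.mem_Icc.2 ⟨h1, h2.trans ht⟩)).mono (ℱ.mono h2) le_rfl

theorem measurable_sd (h : IsNoiseModel ℱ P T A R a s e)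
    {i t : ℕ} (hi : i ∈ Finset.Icc 1 t) (ht : t ≤ T) :
    Measurable[ℱ t] (s i) := by
  obtain ⟨h1, h2⟩ := Finset.mem_Icc.1 hi
  exact (h.meas_sd i (Finset.mem_Icc.2 ⟨h1, h2.trans ht⟩)).mono (ℱ.mono h2) le_rfl

theorem measurable_noise (h : IsNoiseModel ℱ P T A R a s e)
    {i t : ℕ} (hi : i ∈ Finset.Ico 1 t) (ht : t ≤ T) :
    Measurable[ℱ t] (e i) := by
  obtain ⟨h1, h2⟩ := Finset.mem_Ico.1 hi
  exact (h.meas_noise i (Finset.mem_Icc.2 ⟨h1, by omega⟩)).mono (ℱ.mono (by omega)) le_rfl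

variable [IsProbabilityMeasure P]

theorem wNoise_mean (h : IsNoiseModel ℱ P T A R a s e)
    (hd : 0 < d) (hR : 0 ≤ R) {t : ℕ} (ht : t ∈ Finset.Icc 1 T) :
    P[fun ω => wNoise d R (fun i => s i ω) (fun i => e i ω) t | ℱ t] =ᵐ[P] fun _ => 0 := by
  have hb : ∀ ω, ‖(sdBar d R (s t ω))⁻¹‖ ≤ √(d : ℝ) / (R + 1) := fun ω => by
    rw [Real.norm_eq_abs, abs_of_pos (inv_pos.2 (sdBar_pos hd hR _))]
    exact inv_sdBar_le hd hR _
  have he : Integrable (e t) P :=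
    .of_bound ((h.meas_noise t ht).mono (ℱ.le _) le_rfl).aestronglyMeasurable R (h.abs_noise t ht)
  have := condExp_stronglyMeasurable_mul_of_bound (μ := P) (ℱ.le t)
    (measurable_sdBar (h.meas_sd t ht) d R).inv.stronglyMeasurable he _ (ae_of_all _ hb)
  filter_upwards [this, h.mean t ht] with ω h1 h2
  refine h1.trans ?_
  simp [h2]

theorem wNoise_var (h : IsNoiseModel ℱ P T A R a s e)
    (hd : 0 < d) (hR : 0 ≤ R) {t : ℕ} (ht : t ∈ Finset.Icc 1 T) :
    P[fun ω => wNoise d R (fun i => s i ω) (fun i => e i ω) t ^ 2 | ℱ t] ≤ᵐ[P] fun _ => 1 := by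
  have hb : ∀ ω, ‖(sdBar d R (s t ω))⁻¹ ^ 2‖ ≤ (√(d : ℝ) / (R + 1)) ^ 2 := fun ω => by
    rw [norm_pow, Real.norm_eq_abs, abs_of_pos (inv_pos.2 (sdBar_pos hd hR _))]
    have := sdBar_pos hd hR (s t ω)
    gcongr
    exact inv_sdBar_le hd hR _
  have he : Integrable (fun ω => e t ω ^ 2) P := by
    refine .of_bound (((h.meas_noise t ht).mono (ℱ.le _) le_rfl).pow_const 2).aestronglyMeasurable
      (R ^ 2) ?_
    filter_upwards [h.abs_noise t ht] with ω h1
    rw [norm_pow, Real.norm_eq_abs]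
    gcongr
  have := condExp_stronglyMeasurable_mul_of_bound (μ := P) (ℱ.le t)
    ((measurable_sdBar (h.meas_sd t ht) d R).inv.pow_const 2).stronglyMeasurable he _
    (ae_of_all _ hb)
  have e1 : (fun ω => wNoise d R (fun i => s i ω) (fun i => e i ω) t ^ 2)
      = (fun ω => (sdBar d R (s t ω))⁻¹ ^ 2) * fun ω => e t ω ^ 2 := by
    ext ω
    simp [wNoise, mul_pow]
  rw [e1]
  filter_upwards [this, h.var t ht, h.sd_nonneg t ht] with ω h1 h2 h3
  refine h1.trans_le ?_
  have h4 := sdBar_pos hd hR (s t ω)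
  have h5 : s t ω ≤ sdBar d R (s t ω) := le_max_right _ _
  simp only [Pi.mul_apply]
  calc (sdBar d R (s t ω))⁻¹ ^ 2 * (P[fun ω => e t ω ^ 2 | ℱ t]) ω
      ≤ (sdBar d R (s t ω))⁻¹ ^ 2 * sdBar d R (s t ω) ^ 2 := by
        gcongr
        exact h2.trans (by gcongr)
    _ = 1 := by rw [← mul_pow, inv_mul_cancel₀ h4.ne', one_pow]

/-- The tail bound for the sum of the increments at a fixed time. -/
theorem measure_sum_noiseIncr_gt_le (h : IsNoiseModel ℱ P T A R a s e)
    (hd : 0 < d) (hR : 0 ≤ R) {lam : ℝ} (hlam : 0 < lam)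
    {δ : ℝ} (hδ : 0 < δ) (hδ1 : δ < 1) {n : ℕ} (hn : n + 1 ≤ T) :
    P {ω | noiseRadius d lam A R δ (n + 1) ^ 2 < ∑ i ∈ Finset.Icc 1 n,
      noiseIncr lam R (noiseRadius d lam A R δ (n + 1)) (fun i => a i ω) (fun i => s i ω)
        (fun i => e i ω) i} ≤ ENNReal.ofReal (δ / (4 * (n + 1 : ℝ) ^ 2)) := by
  set l : ℝ := Real.log (4 * ((n + 1 : ℕ) : ℝ) ^ 2 / δ) with hl
  have hl1 : 1 ≤ l := one_le_log_radius hδ hδ1 (by omega)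
  set V : ℝ := d * logRatio lam A R (n + 1) with hV
  have hV0 : 0 ≤ V := mul_nonneg (by positivity) (logRatio_nonneg hlam A hR _)
  have hM : 0 < √(d : ℝ) := by positivity
  obtain ⟨θ, hθ, htilt, hfin⟩ := exists_tilt hV0 hl1 hM
  set β : ℝ := noiseRadius d lam A R δ (n + 1) with hβ
  have hβ0 : 0 ≤ β := noiseRadius_nonneg d lam A R hδ hδ1 (by omega)
  have hβe : 8 * √(V * l) + 4 * √(d : ℝ) * l = β := rfl
  rw [hβe] at htilt hfin
  set κ : ℝ := θ + θ ^ 2 * (4 * β ^ 2 + √(d : ℝ) ^ 2) with hκ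
  have hκ0 : 0 ≤ κ := by positivity
  set X : ℕ → Ω → ℝ := fun i ω =>
    noiseIncr lam R β (fun i => a i ω) (fun i => s i ω) (fun i => e i ω) i with hX
  have hsub : ∀ i ∈ Finset.Icc 1 n, i ∈ Finset.Icc 1 T := fun i hi => by
    simp at hi ⊢; omega
  have hηm : ∀ i ∈ Finset.Icc 1 n, Measurable[ℱ (i + 1)]
      fun ω => wNoise d R (fun i => s i ω) (fun i => e i ω) i := fun i hi =>
    measurable_wNoise d R ((h.meas_sd i (hsub i hi)).mono (ℱ.mono (by omega)) le_rfl)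
      (h.meas_noise i (hsub i hi))
  have hle : ∀ i ∈ Finset.Icc 1 n, 1 ≤ i ∧ i ≤ T := fun i hi => Finset.mem_Icc.1 (hsub i hi)
  have hcm : ∀ i ∈ Finset.Icc 1 n, Measurable[ℱ i] fun ω =>
      crossTerm lam R β (fun i => a i ω) (fun i => s i ω) (fun i => e i ω) i := fun i hi =>
    measurable_crossTerm lam R β (fun j hj => h.measurable_act hj (hle i hi).2)
      (fun j hj => h.measurable_sd hj (hle i hi).2) (fun j hj => h.measurable_noise hj (hle i hi).2)
      (hle i hi).1
  have hwm : ∀ i ∈ Finset.Icc 1 n, Measurable[ℱ i] fun ω =>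
      wSq lam R (fun i => a i ω) (fun i => s i ω) i := fun i hi =>
    measurable_wSq lam R (fun j hj => h.measurable_act hj (hle i hi).2)
      (fun j hj => h.measurable_sd hj (hle i hi).2) (hle i hi).1
  have hvm : ∀ i ∈ Finset.Icc 1 n, Measurable[ℱ i] fun ω =>
      leverage lam R (fun i => a i ω) (fun i => s i ω) i := fun i hi =>
    measurable_leverage lam R (fun j hj => h.measurable_act hj (hle i hi).2)
      (fun j hj => h.measurable_sd hj (hle i hi).2) (hle i hi).1
  have hcb : ∀ i ω, |crossTerm lam R β (fun i => a i ω) (fun i => s i ω) (fun i => e i ω) i|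
      ≤ √(wSq lam R (fun i => a i ω) (fun i => s i ω) i) * β := fun i ω =>
    abs_crossTerm_le hlam R hβ0 _ _ _ i
  have hgb : ∀ i ω, |2 * θ * crossTerm lam R β (fun i => a i ω) (fun i => s i ω) (fun i => e i ω) i
      / (1 + wSq lam R (fun i => a i ω) (fun i => s i ω) i)| ≤ √(d : ℝ) + θ * β := by
    intro i ω
    have h1 := hcb i ω
    have h0 := wSq_nonneg hlam R (fun i => a i ω) (fun i => s i ω) i
    set w := √(wSq lam R (fun i => a i ω) (fun i => s i ω) i) with hw
    have h2 : wSq lam R (fun i => a i ω) (fun i => s i ω) i = w ^ 2 := (Real.sq_sqrt h0).symm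
    rw [h2, abs_div, abs_mul, abs_of_pos (show 0 < 2 * θ by positivity),
      abs_of_pos (show 0 < 1 + w ^ 2 by positivity), div_le_iff₀ (by positivity)]
    have h3 : 2 * θ * |crossTerm lam R β (fun i => a i ω) (fun i => s i ω) (fun i => e i ω) i|
        ≤ 2 * θ * (w * β) := by gcongr
    have h4 : 0 ≤ θ * β * (w - 1) ^ 2 := by positivity
    have h5 : 0 ≤ √(d : ℝ) * (1 + w ^ 2) := by positivity
    linarith
  have hexp : ∀ i ∈ Finset.Icc 1 n, ∀ᵐ ω ∂P, Real.exp (θ * X i ω)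
      ≤ 1 + wNoise d R (fun i => s i ω) (fun i => e i ω) i
        * (2 * θ * crossTerm lam R β (fun i => a i ω) (fun i => s i ω) (fun i => e i ω) i
          / (1 + wSq lam R (fun i => a i ω) (fun i => s i ω) i))
        + wNoise d R (fun i => s i ω) (fun i => e i ω) i ^ 2
          * (κ * leverage lam R (fun i => a i ω) (fun i => s i ω) i) := by
    intro i hi
    filter_upwards [h.abs_noise i (hsub i hi)] with ω h1
    have h2 := exp_quadratic_le hθ.le hM.le hβ0
      (abs_wNoise_le (s := fun i => s i ω) (e := fun i => e i ω) hd hR h1) (hcb i ω) htilt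
    rwa [Real.sq_sqrt (wSq_nonneg hlam R _ _ i)] at h2
  have hXm : ∀ i ∈ Finset.Icc 1 n, Measurable[ℱ (i + 1)] (X i) := by
    intro i hi
    have hm1 := (hcm i hi).mono (ℱ.mono (Nat.le_succ i)) le_rfl
    have hm2 := (hwm i hi).mono (ℱ.mono (Nat.le_succ i)) le_rfl
    have hm3 := (hvm i hi).mono (ℱ.mono (Nat.le_succ i)) le_rfl
    exact ((hηm i hi).mul ((hm1.const_mul 2).div (hm2.const_add 1))).add
      (((hηm i hi).pow_const 2).mul hm3)
  have hXb : ∀ i ∈ Finset.Icc 1 n, ∀ᵐ ω ∂P, θ * X i ω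
      ≤ √(d : ℝ) * (√(d : ℝ) + θ * β) + √(d : ℝ) ^ 2 * κ := by
    intro i hi
    filter_upwards [hexp i hi, h.abs_noise i (hsub i hi)] with ω h1 h2
    have h3 := abs_wNoise_le (s := fun i => s i ω) (e := fun i => e i ω) hd hR h2
    have h4 := Real.add_one_le_exp (θ * X i ω)
    have h5 := (le_abs_self _).trans ((abs_mul _ _).trans_le
      (mul_le_mul h3 (hgb i ω) (abs_nonneg _) hM.le))
    have h6 : wNoise d R (fun i => s i ω) (fun i => e i ω) i ^ 2
        * (κ * leverage lam R (fun i => a i ω) (fun i => s i ω) i) ≤ √(d : ℝ) ^ 2 * κ := by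
      rw [← sq_abs]
      have := leverage_nonneg hlam R (fun i => a i ω) (fun i => s i ω) i
      gcongr
      exact mul_le_of_le_one_right hκ0 (leverage_le_one hlam R _ _ i)
    linarith
  obtain ⟨hint, hmain⟩ := integral_exp_sum_le_one (P := P) ℱ (T := n)
    (η := fun i ω => wNoise d R (fun i => s i ω) (fun i => e i ω) i)
    (g := fun i ω => 2 * θ * crossTerm lam R β (fun i => a i ω) (fun i => s i ω) (fun i => e i ω) i
          / (1 + wSq lam R (fun i => a i ω) (fun i => s i ω) i))
    (v := fun i ω => leverage lam R (fun i => a i ω) (fun i => s i ω) i)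
    (Y := fun i ω => θ * X i ω) (c := √(d : ℝ) + θ * β) hκ0 hηm
    (fun i hi => (hXm i hi).const_mul θ)
    (fun i hi => ((hcm i hi).const_mul (2 * θ)).div ((hwm i hi).const_add 1)) hvm
    (fun i hi => by
      filter_upwards [h.abs_noise i (hsub i hi)] with ω h1
      exact (abs_wNoise_le hd hR h1).trans (le_add_of_nonneg_right (by positivity)))
    (fun i _ => ae_of_all _ (hgb i)) (fun i _ => ae_of_all _ fun ω => leverage_nonneg hlam R _ _ i)
    (fun i _ => ae_of_all _ fun ω => leverage_le_one hlam R _ _ i) hXb hexp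
    (fun i hi => h.wNoise_mean hd hR (hsub i hi)) (fun i hi => h.wNoise_var hd hR (hsub i hi))
    n le_rfl
  have hmarkov := mul_meas_ge_le_integral_of_nonneg
    (ae_of_all P fun ω => (Real.exp_pos (∑ i ∈ Finset.Icc 1 n, (θ * X i ω
      - κ * leverage lam R (fun i => a i ω) (fun i => s i ω) i))).le) hint (Real.exp l)
  have hprob := hmarkov.trans hmain
  have hact : ∀ᵐ ω ∂P, ∀ i ∈ Finset.Icc 1 n, ‖a i ω‖ ≤ A := by
    rw [Finset.eventually_all]
    exact fun i hi => h.norm_act i (hsub i hi)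
  calc P {ω | β ^ 2 < ∑ i ∈ Finset.Icc 1 n, X i ω}
      ≤ P {ω | Real.exp l ≤ Real.exp (∑ i ∈ Finset.Icc 1 n, (θ * X i ω
          - κ * leverage lam R (fun i => a i ω) (fun i => s i ω) i))} := by
        refine measure_mono_ae ?_
        filter_upwards [hact] with ω h1 h2
        have h2 : β ^ 2 < ∑ i ∈ Finset.Icc 1 n, X i ω := h2
        have h3 := (sum_leverage_le hd hlam hR (fun i => a i ω) (fun i => s i ω) n h1).trans
          (mul_le_mul_of_nonneg_left (logRatio_mono hlam A hR (Nat.le_succ n))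
            (Nat.cast_nonneg d))
        refine Real.exp_le_exp.2 ?_
        rw [Finset.sum_sub_distrib, ← Finset.mul_sum, ← Finset.mul_sum]
        have h4 := mul_le_mul_of_nonneg_left h3 hκ0
        have h5 := mul_le_mul_of_nonneg_left h2.le hθ.le
        linarith
    _ ≤ ENNReal.ofReal (δ / (4 * (n + 1 : ℝ) ^ 2)) := by
        rw [← ofReal_measureReal]
        refine ENNReal.ofReal_le_ofReal ?_
        have h6 : Real.exp l = 4 * (n + 1 : ℝ) ^ 2 / δ := by
          rw [hl, Real.exp_log (by positivity)]
          push_cast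
          rfl
        rw [h6] at hprob ⊢
        rw [le_div_iff₀ (by positivity)]
        rw [div_mul_eq_mul_div, div_le_one hδ] at hprob
        linarith

/-- The self-normalized Bernstein inequality, uniformly in time. -/
theorem measure_noise_gt_le (h : IsNoiseModel ℱ P T A R a s e)
    (hd : 0 < d) (hR : 0 ≤ R) {lam : ℝ} (hlam : 0 < lam)
    {δ : ℝ} (hδ : 0 < δ) (hδ1 : δ < 1) :
    P {ω | ∃ t ∈ Finset.Icc 1 T, noiseRadius d lam A R δ t
      < invNorm (CorruptedBandit.gram lam R (fun i => a i ω) (fun i => s i ω) t)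
        (noiseSum R (fun i => a i ω) (fun i => s i ω) (fun i => e i ω) t)} ≤ ENNReal.ofReal δ := by
  set E : ℕ → Set Ω := fun n => {ω | noiseRadius d lam A R δ (n + 1) ^ 2 < ∑ i ∈ Finset.Icc 1 n,
      noiseIncr lam R (noiseRadius d lam A R δ (n + 1)) (fun i => a i ω) (fun i => s i ω)
        (fun i => e i ω) i} with hE
  have hsub : {ω | ∃ t ∈ Finset.Icc 1 T, noiseRadius d lam A R δ t
      < invNorm (CorruptedBandit.gram lam R (fun i => a i ω) (fun i => s i ω) t)
        (noiseSum R (fun i => a i ω) (fun i => s i ω) (fun i => e i ω) t)}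
      ⊆ ⋃ n ∈ Finset.range T, E n := by
    intro ω hω
    by_contra hcon
    simp only [Set.mem_iUnion, not_exists, hE, Set.mem_ofPred_eq, not_lt] at hcon
    have key : ∀ t, 1 ≤ t → t ≤ T → noiseSq lam R (fun i => a i ω) (fun i => s i ω)
        (fun i => e i ω) t ≤ noiseRadius d lam A R δ t ^ 2 := by
      intro t
      induction t using Nat.strong_induction_on with
      | _ t ih =>
        intro h1 hT
        obtain ⟨n, rfl⟩ : ∃ n, t = n + 1 := ⟨t - 1, by omega⟩
        refine (noiseSq_le_sum hlam R _ _ _ _ n fun j hj => ?_).trans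
          (hcon n (Finset.mem_range.2 (by omega)))
        obtain ⟨hj1, hj2⟩ := Finset.mem_Icc.1 hj
        have h0 := noiseRadius_nonneg d lam A R hδ hδ1 hj1
        refine (ih j (by omega) hj1 (by omega)).trans ?_
        have := noiseRadius_mono d hlam A hR hδ hδ1 hj1 (show j ≤ n + 1 by omega)
        gcongr
    obtain ⟨t, ht, hlt⟩ := hω
    obtain ⟨h1, h2⟩ := Finset.mem_Icc.1 ht
    exact absurd (Real.sqrt_le_iff.2 ⟨noiseRadius_nonneg d lam A R hδ hδ1 h1, key t h1 h2⟩)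
      (not_le.2 hlt)
  calc _ ≤ P (⋃ n ∈ Finset.range T, E n) := measure_mono hsub
    _ ≤ ∑ n ∈ Finset.range T, P (E n) := measure_biUnion_finset_le _ _
    _ ≤ ∑ n ∈ Finset.range T, ENNReal.ofReal (δ / (4 * (n + 1 : ℝ) ^ 2)) :=
        Finset.sum_le_sum fun n hn => h.measure_sum_noiseIncr_gt_le hd hR hlam hδ hδ1
          (Finset.mem_range.1 hn)
    _ = ENNReal.ofReal (∑ n ∈ Finset.range T, δ / (4 * (n + 1 : ℝ) ^ 2)) :=
        (ENNReal.ofReal_sum_of_nonneg fun n _ => by positivity).symm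
    _ ≤ ENNReal.ofReal δ := by
        refine ENNReal.ofReal_le_ofReal ?_
        have h1 := sum_inv_sq_le T
        have h2 : (0 : ℝ) ≤ 1 / (T + 1) := by positivity
        calc ∑ n ∈ Finset.range T, δ / (4 * (n + 1 : ℝ) ^ 2)
            = δ * ∑ n ∈ Finset.range T, 1 / (4 * (n + 1 : ℝ) ^ 2) := by
              rw [Finset.mul_sum]
              exact Finset.sum_congr rfl fun n _ => by ring
          _ ≤ δ * 1 := by gcongr; linarith
          _ = δ := mul_one δ

end IsNoiseModel

end Concentration

/-! ### The confidence ellipsoid and the regret along one trajectory -/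

section Confidence

variable {d : ℕ}

theorem inner_eq_dotProduct (x y : Vec d) : inner ℝ x y = x.ofLp ⬝ᵥ y.ofLp := by
  simp [PiLp.inner_apply, dotProduct, mul_comm]

theorem dotProduct_self_eq (x : Vec d) : x.ofLp ⬝ᵥ x.ofLp = ‖x‖ ^ 2 := by
  rw [← inner_eq_dotProduct, real_inner_self_eq_norm_sq]

theorem gram_mulVec (lam R : ℝ) (a : ℕ → Vec d) (s : ℕ → ℝ) (t : ℕ) (y : Fin d → ℝ) :
    CorruptedBandit.gram lam R a s t *ᵥ y
      = lam • y + ∑ i ∈ Finset.Ico 1 t, (wAct R a s i ⬝ᵥ y) • wAct R a s i := by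
  simp only [CorruptedBandit.gram, ← vecMulVec_wAct]
  rw [add_mulVec, smul_mulVec, one_mulVec, sum_mulVec]
  simp [vecMulVec_mulVec]

theorem dotProduct_gram_mulVec (lam R : ℝ) (a : ℕ → Vec d) (s : ℕ → ℝ) (t : ℕ) (y : Fin d → ℝ) :
    y ⬝ᵥ (CorruptedBandit.gram lam R a s t *ᵥ y)
      = lam * (y ⬝ᵥ y) + ∑ i ∈ Finset.Ico 1 t, (wAct R a s i ⬝ᵥ y) ^ 2 := by
  rw [gram_mulVec, dotProduct_add, dotProduct_smul, dotProduct_sum, smul_eq_mul]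
  congr 1
  refine Finset.sum_congr rfl fun i _ => ?_
  rw [dotProduct_smul, smul_eq_mul, dotProduct_comm y, sq]

theorem invNorm_wAct_le_one {lam : ℝ} (hlam : 0 < lam) (R : ℝ) (a : ℕ → Vec d) (s : ℕ → ℝ)
    {t i : ℕ} (hi : i ∈ Finset.Ico 1 t) :
    invNorm (CorruptedBandit.gram lam R a s t) (wAct R a s i) ≤ 1 := by
  refine invNorm_le _ (gram_posDef hlam R a s t) zero_le_one fun y => ?_
  rw [dotProduct_gram_mulVec, one_pow, one_mul]
  have h1 := Finset.single_le_sum (f := fun i => (wAct R a s i ⬝ᵥ y) ^ 2)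
    (fun i _ => sq_nonneg _) hi
  have h2 : 0 ≤ y ⬝ᵥ y := by simpa using dotProduct_star_self_nonneg y
  have := mul_nonneg hlam.le h2
  linarith

theorem invNorm_smul_theta_le {lam : ℝ} (hlam : 0 < lam) (R : ℝ) (a : ℕ → Vec d) (s : ℕ → ℝ)
    (t : ℕ) {B : ℝ} (hB : 0 ≤ B) {θ : Vec d} (hθ : ‖θ‖ ≤ B) :
    invNorm (CorruptedBandit.gram lam R a s t) (lam • θ.ofLp) ≤ √lam * B := by
  have h : invNorm (CorruptedBandit.gram lam R a s t) (√lam • θ.ofLp) ≤ B := by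
    refine invNorm_le _ (gram_posDef hlam R a s t) hB fun y => ?_
    have h1 : (θ.ofLp ⬝ᵥ y) ^ 2 ≤ B ^ 2 * (y ⬝ᵥ y) := by
      have h2 := abs_real_inner_le_norm θ (WithLp.toLp 2 y)
      rw [inner_eq_dotProduct] at h2
      calc (θ.ofLp ⬝ᵥ y) ^ 2 ≤ (‖θ‖ * ‖(WithLp.toLp 2 y : Vec d)‖) ^ 2 := by
            rw [← sq_abs]
            gcongr
        _ = ‖θ‖ ^ 2 * (y ⬝ᵥ y) := by rw [mul_pow, ← dotProduct_self_eq (WithLp.toLp 2 y)]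
        _ ≤ B ^ 2 * (y ⬝ᵥ y) := by
            have : 0 ≤ y ⬝ᵥ y := by simpa using dotProduct_star_self_nonneg y
            gcongr
    rw [dotProduct_gram_mulVec, smul_dotProduct, smul_eq_mul, mul_pow, Real.sq_sqrt hlam.le]
    have h3 : 0 ≤ ∑ i ∈ Finset.Ico 1 t, (wAct R a s i ⬝ᵥ y) ^ 2 :=
      Finset.sum_nonneg fun i _ => sq_nonneg _
    nlinarith [mul_le_mul_of_nonneg_left h1 hlam.le, mul_nonneg (sq_nonneg B) h3]
  calc invNorm (CorruptedBandit.gram lam R a s t) (lam • θ.ofLp)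
      = √lam * invNorm (CorruptedBandit.gram lam R a s t) (√lam • θ.ofLp) := by
        rw [← abs_of_nonneg (Real.sqrt_nonneg lam), ← invNorm_smul, smul_smul,
          abs_of_nonneg (Real.sqrt_nonneg lam), Real.mul_self_sqrt hlam.le]
    _ ≤ √lam * B := by gcongr

/-- The estimation error is at most the noise plus the effect of the corruption and of the
regularization. -/
theorem matNorm_sub_estimate_le (hd : 0 < d) {lam : ℝ} (hlam : 0 < lam) {R : ℝ} (hR : 0 ≤ R)
    (a : ℕ → Vec d) (s e y c : ℕ → ℝ) (t : ℕ) {B C : ℝ} (hB : 0 ≤ B) {θ : Vec d} (hθ : ‖θ‖ ≤ B)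
    (hy : ∀ i ∈ Finset.Ico 1 t, y i = inner ℝ (a i) θ + e i + c i)
    (hc : ∑ i ∈ Finset.Ico 1 t, |c i| ≤ C * (R + 1)) :
    matNorm (CorruptedBandit.gram lam R a s t) (θ - estimate lam R a s y t)
      ≤ invNorm (CorruptedBandit.gram lam R a s t) (noiseSum R a s e t) + C * √(d : ℝ)
        + √lam * B := by
  have hZ := gram_posDef hlam R a s t
  have key : CorruptedBandit.gram lam R a s t *ᵥ (θ - estimate lam R a s y t).ofLp
      = (-1 : ℝ) • noiseSum R a s e t
        + (-1 : ℝ) • ∑ i ∈ Finset.Ico 1 t, wNoise d R s c i • wAct R a s i + lam • θ.ofLp := by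
    have h1 : CorruptedBandit.gram lam R a s t *ᵥ (estimate lam R a s y t).ofLp
        = (moment R a s y t).ofLp := by
      rw [estimate, mulVec_mulVec, mul_nonsing_inv _ (isUnit_det hZ), one_mulVec]
    have h2 : (moment R a s y t).ofLp = ∑ i ∈ Finset.Ico 1 t,
        ((wAct R a s i ⬝ᵥ θ.ofLp) • wAct R a s i + wNoise d R s e i • wAct R a s i
          + wNoise d R s c i • wAct R a s i) := by
      rw [moment, WithLp.ofLp_sum]
      refine Finset.sum_congr rfl fun i hi => ?_
      rw [hy i hi, inner_eq_dotProduct, ← add_smul, ← add_smul, wAct, wNoise, wNoise,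
        smul_dotProduct, smul_smul, WithLp.ofLp_smul, smul_eq_mul]
      congr 1
      have := (sdBar_pos hd hR (s i)).ne'
      field_simp
    rw [WithLp.ofLp_sub, mulVec_sub, h1, h2, gram_mulVec, Finset.sum_add_distrib,
      Finset.sum_add_distrib, noiseSum, neg_one_smul, neg_one_smul]
    abel
  have hcorr : invNorm (CorruptedBandit.gram lam R a s t)
      (∑ i ∈ Finset.Ico 1 t, wNoise d R s c i • wAct R a s i) ≤ C * √(d : ℝ) := by
    refine (invNorm_sum_le hZ _ _).trans ?_
    calc ∑ i ∈ Finset.Ico 1 t,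
          invNorm (CorruptedBandit.gram lam R a s t) (wNoise d R s c i • wAct R a s i)
        ≤ ∑ i ∈ Finset.Ico 1 t, √(d : ℝ) / (R + 1) * |c i| := by
          refine Finset.sum_le_sum fun i hi => ?_
          rw [invNorm_smul, wNoise, abs_mul, abs_of_pos (inv_pos.2 (sdBar_pos hd hR _))]
          refine (mul_le_of_le_one_right ?_ (invNorm_wAct_le_one hlam R a s hi)).trans ?_
          · exact mul_nonneg (inv_pos.2 (sdBar_pos hd hR _)).le (abs_nonneg _)
          · exact mul_le_mul_of_nonneg_right (inv_sdBar_le hd hR _) (abs_nonneg _)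
      _ = √(d : ℝ) / (R + 1) * ∑ i ∈ Finset.Ico 1 t, |c i| := (Finset.mul_sum _ _ _).symm
      _ ≤ √(d : ℝ) / (R + 1) * (C * (R + 1)) := by gcongr
      _ = C * √(d : ℝ) := by field_simp
  rw [matNorm_eq_invNorm hZ, key]
  refine (invNorm_add_le _ _ hZ).trans (add_le_add ((invNorm_add_le _ _ hZ).trans (add_le_add ?_ ?_))
    (invNorm_smul_theta_le hlam R a s t hB hθ))
  · rw [invNorm_smul]
    simp
  · rw [invNorm_smul]
    simpa using hcorr

section Ellipsoid

variable {Z : Matrix (Fin d) (Fin d) ℝ} {c : Vec d} {ρ : ℝ}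

theorem abs_inner_sub_le (hZ : Z.PosDef) {m : Vec d} (hm : matNorm Z (m - c) ≤ ρ) (x : Vec d) :
    |inner ℝ m x - inner ℝ c x| ≤ ρ * invNorm Z x.ofLp := by
  rw [← inner_sub_left, inner_eq_dotProduct]
  exact (abs_dotProduct_le _ hZ _).trans (mul_le_mul_of_nonneg_right hm (invNorm_nonneg _))

theorem inner_le_optValue (hZ : Z.PosDef) {m : Vec d} (hm : matNorm Z (m - c) ≤ ρ) (x : Vec d) :
    inner ℝ m x ≤ optValue {m | matNorm Z (m - c) ≤ ρ} x := by
  refine le_csSup ⟨inner ℝ c x + ρ * invNorm Z x.ofLp, ?_⟩ (Set.mem_image_of_mem _ hm)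
  rintro _ ⟨m', hm', rfl⟩
  have := (abs_le.1 (abs_inner_sub_le hZ hm' x)).2
  simp only
  linarith

theorem optValue_le (hZ : Z.PosDef) {m : Vec d} (hm : matNorm Z (m - c) ≤ ρ) (x : Vec d) :
    optValue {m | matNorm Z (m - c) ≤ ρ} x ≤ inner ℝ m x + 2 * ρ * invNorm Z x.ofLp := by
  refine csSup_le ⟨_, Set.mem_image_of_mem _ hm⟩ ?_
  rintro _ ⟨m', hm', rfl⟩
  have h1 := (abs_le.1 (abs_inner_sub_le hZ hm' x)).2
  have h2 := (abs_le.1 (abs_inner_sub_le hZ hm x)).1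
  simp only
  linarith

/-- Optimism: an action that is optimal for the ellipsoid has small regret. -/
theorem sSup_sub_inner_le (hZ : Z.PosDef) {θ : Vec d} (hθ : matNorm Z (θ - c) ≤ ρ)
    {D : Set (Vec d)} {x : Vec d} (hx : x ∈ D)
    (hmax : IsMaxOn (optValue {m | matNorm Z (m - c) ≤ ρ}) D x) :
    sSup ((fun a : Vec d => inner ℝ a θ) '' D) - inner ℝ x θ ≤ 2 * ρ * invNorm Z x.ofLp := by
  rw [sub_le_iff_le_add]
  refine csSup_le ⟨_, Set.mem_image_of_mem _ hx⟩ ?_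
  rintro _ ⟨a, ha, rfl⟩
  have h1 := inner_le_optValue hZ hθ a
  have h2 : optValue _ a ≤ optValue _ x := hmax ha
  have h3 := optValue_le hZ hθ x
  simp only
  rw [real_inner_comm θ a, real_inner_comm θ x]
  linarith

end Ellipsoid

theorem sSup_sub_inner_le_two {D : Set (Vec d)} {θ x : Vec d} (hx : x ∈ D)
    (h : ∀ a ∈ D, |(inner ℝ a θ : ℝ)| ≤ 1) :
    sSup ((fun a : Vec d => inner ℝ a θ) '' D) - inner ℝ x θ ≤ 2 := by
  have h1 : sSup ((fun a : Vec d => inner ℝ a θ) '' D) ≤ 1 := by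
    refine csSup_le ⟨_, Set.mem_image_of_mem _ hx⟩ ?_
    rintro _ ⟨a, ha, rfl⟩
    exact (abs_le.1 (h a ha)).2
  have h2 := (abs_le.1 (h x hx)).1
  linarith

end Confidence

/-! ### The regret bound -/

section Regret

variable {d : ℕ}

theorem radius_eq (d : ℕ) (lam A B R C δ : ℝ) (t : ℕ) :
    radius d lam A B R C δ t = noiseRadius d lam A R δ t + C * √(d : ℝ) + √lam * B := rfl

theorem invNorm_act (hd : 0 < d) {R : ℝ} (hR : 0 ≤ R) (lam : ℝ) (a : ℕ → Vec d) (s : ℕ → ℝ)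
    (t : ℕ) : invNorm (CorruptedBandit.gram lam R a s t) (a t).ofLp
      = sdBar d R (s t) * √(wSq lam R a s t) := by
  have h := sdBar_pos hd hR (s t)
  have e : (a t).ofLp = sdBar d R (s t) • wAct R a s t := by
    rw [wAct, smul_smul, mul_inv_cancel₀ h.ne', one_smul]
  conv_lhs => rw [e]
  rw [invNorm_smul, abs_of_pos h]
  rfl

theorem sum_sdBar_sq_le (hd : 0 < d) {R : ℝ} (hR : 0 ≤ R) (s : ℕ → ℝ) (T : ℕ) :
    √(∑ t ∈ Finset.Icc 1 T, sdBar d R (s t) ^ 2)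
      ≤ √T * ((R + 1) / √(d : ℝ)) + √(∑ t ∈ Finset.Icc 1 T, s t ^ 2) := by
  have h0 : 0 ≤ ∑ t ∈ Finset.Icc 1 T, s t ^ 2 := Finset.sum_nonneg fun _ _ => sq_nonneg _
  have h1 : ∑ t ∈ Finset.Icc 1 T, sdBar d R (s t) ^ 2
      ≤ T * ((R + 1) / √(d : ℝ)) ^ 2 + ∑ t ∈ Finset.Icc 1 T, s t ^ 2 := by
    calc ∑ t ∈ Finset.Icc 1 T, sdBar d R (s t) ^ 2
        ≤ ∑ t ∈ Finset.Icc 1 T, (((R + 1) / √(d : ℝ)) ^ 2 + s t ^ 2) := by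
          refine Finset.sum_le_sum fun t _ => ?_
          rcases max_choice ((R + 1) / √(d : ℝ)) (s t) with h | h <;> rw [sdBar, h] <;>
            nlinarith [sq_nonneg (s t), sq_nonneg ((R + 1) / √(d : ℝ))]
      _ = _ := by rw [Finset.sum_add_distrib]; simp
  refine Real.sqrt_le_iff.2 ⟨by positivity, h1.trans ?_⟩
  rw [add_sq, mul_pow, Real.sq_sqrt (by positivity), Real.sq_sqrt h0]
  have : 0 ≤ 2 * (√T * ((R + 1) / √(d : ℝ))) * √(∑ t ∈ Finset.Icc 1 T, s t ^ 2) := by positivity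
  linarith

/-- Summing the per-round bounds by the Cauchy–Schwarz inequality and the elliptical potential
bound. -/
theorem sum_regret_le (hd : 0 < d) {lam : ℝ} (hlam : 0 < lam) {R A α c₀ : ℝ} (hR : 0 ≤ R)
    (hc₀ : 0 < c₀) (hα : ∀ s : ℝ, c₀ ^ 2 ≤ α * sdBar d R s) (hα0 : 0 ≤ α) (a : ℕ → Vec d)
    (s r : ℕ → ℝ) (T : ℕ) (ha : ∀ i ∈ Finset.Icc 1 T, ‖a i‖ ≤ A)
    (hr2 : ∀ t ∈ Finset.Icc 1 T, r t ≤ 2)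
    (hr : ∀ t ∈ Finset.Icc 1 T, r t ≤ 2 * α * (sdBar d R (s t) * √(wSq lam R a s t))) :
    ∑ t ∈ Finset.Icc 1 T, r t ≤ 2 * (1 + 1 / c₀ ^ 2) * α *
      ((√T * ((R + 1) / √(d : ℝ)) + √(∑ t ∈ Finset.Icc 1 T, s t ^ 2))
        * √(2 * (d * logRatio lam A R T))) := by
  have hround : ∀ t ∈ Finset.Icc 1 T, r t ≤ 2 * (1 + 1 / c₀ ^ 2) * α *
      (sdBar d R (s t) * √(2 * leverage lam R a s t)) := by
    intro t ht
    have hw := wSq_nonneg hlam R a s t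
    have hb := sdBar_pos hd hR (s t)
    have hc : 0 ≤ 1 / c₀ ^ 2 := by positivity
    rcases le_total (wSq lam R a s t) 1 with h1 | h1
    · have h2 : √(wSq lam R a s t) ≤ √(2 * leverage lam R a s t) := by
        refine Real.sqrt_le_sqrt ?_
        rw [leverage, ← mul_div_assoc, le_div_iff₀ (by positivity)]
        nlinarith
      calc r t ≤ 2 * α * (sdBar d R (s t) * √(wSq lam R a s t)) := hr t ht
        _ ≤ 2 * α * (sdBar d R (s t) * √(2 * leverage lam R a s t)) := by gcongr
        _ ≤ 2 * α * (sdBar d R (s t) * √(2 * leverage lam R a s t)) * (1 + 1 / c₀ ^ 2) :=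
            le_mul_of_one_le_right (by positivity) (by linarith)
        _ = _ := by ring
    · have h2 : 1 ≤ √(2 * leverage lam R a s t) := by
        refine Real.one_le_sqrt.2 ?_
        rw [leverage, ← mul_div_assoc, le_div_iff₀ (by positivity)]
        linarith
      calc r t ≤ 2 := hr2 t ht
        _ = 2 * (1 / c₀ ^ 2) * c₀ ^ 2 := by field_simp
        _ ≤ 2 * (1 + 1 / c₀ ^ 2) * (α * sdBar d R (s t)) := by
            gcongr
            · linarith
            · exact hα _
        _ ≤ 2 * (1 + 1 / c₀ ^ 2) * (α * sdBar d R (s t)) * √(2 * leverage lam R a s t) :=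
            le_mul_of_one_le_right (by positivity) h2
        _ = _ := by ring
  calc ∑ t ∈ Finset.Icc 1 T, r t
      ≤ 2 * (1 + 1 / c₀ ^ 2) * α
        * ∑ t ∈ Finset.Icc 1 T, sdBar d R (s t) * √(2 * leverage lam R a s t) := by
        rw [Finset.mul_sum]
        exact Finset.sum_le_sum hround
    _ ≤ 2 * (1 + 1 / c₀ ^ 2) * α * (√(∑ t ∈ Finset.Icc 1 T, sdBar d R (s t) ^ 2)
        * √(∑ t ∈ Finset.Icc 1 T, √(2 * leverage lam R a s t) ^ 2)) := by
        gcongr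
        exact Real.sum_mul_le_sqrt_mul_sqrt _ _ _
    _ ≤ _ := by
        have h1 : ∑ t ∈ Finset.Icc 1 T, √(2 * leverage lam R a s t) ^ 2
            ≤ 2 * (d * logRatio lam A R T) := by
          refine le_trans (le_of_eq ?_) (mul_le_mul_of_nonneg_left
            (sum_leverage_le hd hlam hR a s T ha) zero_le_two)
          rw [Finset.mul_sum]
          exact Finset.sum_congr rfl fun t _ =>
            Real.sq_sqrt (mul_nonneg zero_le_two (leverage_nonneg hlam R a s t))
        gcongr
        exact sum_sdBar_sq_le hd hR s T

/-- The argument of the logarithm in the regret bound. -/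
noncomputable def logArg (T : ℕ) (A B δ : ℝ) : ℝ := 2 + T + A * B + 1 / δ

section Logarithms

variable {T : ℕ} {A B R C δ : ℝ}

theorem logArg_ge (hA : 0 ≤ A) (hB : 0 < B) (hδ : 0 < δ) (hδ1 : δ < 1) :
    3 ≤ logArg T A B δ := by
  have h1 : 1 < 1 / δ := by rwa [lt_one_div one_pos hδ, one_div_one]
  have h2 : (0 : ℝ) ≤ T := T.cast_nonneg
  have h3 := mul_nonneg hA hB.le
  unfold logArg
  linarith

theorem one_le_log_logArg (hA : 0 ≤ A) (hB : 0 < B) (hδ : 0 < δ) (hδ1 : δ < 1) :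
    1 ≤ Real.log (logArg T A B δ) := by
  have h := logArg_ge (T := T) hA hB hδ hδ1
  rw [Real.le_log_iff_exp_le (by linarith)]
  linarith [Real.exp_one_lt_d9]

theorem logRatio_le (hA : 0 ≤ A) (hB : 0 < B) (hR : 0 ≤ R) (hδ : 0 < δ) (hδ1 : δ < 1) :
    logRatio (1 / B ^ 2) A R T ≤ 3 * Real.log (logArg T A B δ) := by
  have h := logArg_ge (T := T) hA hB hδ hδ1
  set X := logArg T A B δ with hX
  have h1 : 1 ≤ 1 / δ := by rw [le_one_div one_pos hδ, one_div_one]; exact hδ1.le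
  have h2 : (0 : ℝ) ≤ T := T.cast_nonneg
  have h3 := mul_nonneg hA hB.le
  have hT : T + 2 ≤ X := by rw [hX, logArg]; linarith
  have hAB : A * B ≤ X := by rw [hX, logArg]; linarith
  rw [show (3 : ℝ) * Real.log X = Real.log (X ^ 3) by rw [Real.log_pow]; norm_num]
  refine Real.log_le_log (by positivity) ?_
  have e : ((R + 1) ^ 2 * (1 / B ^ 2) + T * A ^ 2) / ((R + 1) ^ 2 * (1 / B ^ 2))
      = 1 + T * (A * B) ^ 2 / (R + 1) ^ 2 := by field_simp
  rw [e]
  have h4 : T * (A * B) ^ 2 / (R + 1) ^ 2 ≤ T * X ^ 2 := by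
    calc T * (A * B) ^ 2 / (R + 1) ^ 2 ≤ T * (A * B) ^ 2 :=
          div_le_self (by positivity) (by nlinarith)
      _ ≤ T * X ^ 2 := by gcongr
  have h5 : (T + 2) * X ^ 2 ≤ X * X ^ 2 := by gcongr
  nlinarith

theorem log_radius_le (hA : 0 ≤ A) (hB : 0 < B) (hδ : 0 < δ) (hδ1 : δ < 1) :
    Real.log (4 * T ^ 2 / δ) ≤ 5 * Real.log (logArg T A B δ) := by
  have h := logArg_ge (T := T) hA hB hδ hδ1
  have h' := one_le_log_logArg (T := T) hA hB hδ hδ1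
  set X := logArg T A B δ with hX
  rcases Nat.eq_zero_or_pos T with h0 | h0
  · rw [h0]
    simp only [Nat.cast_zero]
    norm_num
    linarith
  have h1 : 0 < 1 / δ := by positivity
  have h2 : (0 : ℝ) ≤ T := T.cast_nonneg
  have h3 := mul_nonneg hA hB.le
  have hT : T ≤ X := by rw [hX, logArg]; linarith
  have hδX : 1 / δ ≤ X := by rw [hX, logArg]; linarith
  have h0' : (0 : ℝ) < T := by exact_mod_cast h0
  rw [show (5 : ℝ) * Real.log X = Real.log (X ^ 5) by rw [Real.log_pow]; norm_num]
  refine Real.log_le_log (by positivity) ?_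
  have h4 : (4 : ℝ) ≤ X ^ 2 := by nlinarith
  calc 4 * (T : ℝ) ^ 2 / δ = 4 * (T : ℝ) ^ 2 * (1 / δ) := by ring
    _ ≤ X ^ 2 * X ^ 2 * X := by gcongr
    _ = X ^ 5 := by ring

theorem radius_le {c₀ : ℝ} (hd : 0 < d) (hA : 0 ≤ A) (hB : 0 < B) (hR : 0 ≤ R) (hc₀ : 0 < c₀)
    (hC : c₀ ≤ C) (hδ : 0 < δ) (hδ1 : δ < 1) :
    radius d (1 / B ^ 2) A B R C δ T
      ≤ (53 / c₀ + 1) * (C * √(d : ℝ) * Real.log (logArg T A B δ)) := by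
  have hx := one_le_log_logArg (T := T) hA hB hδ hδ1
  have hL := logRatio_le (T := T) hA hB hR hδ hδ1
  have hl := log_radius_le (T := T) hA hB hδ hδ1
  set x := Real.log (logArg T A B δ) with hxdef
  have hL0 := logRatio_nonneg (lam := 1 / B ^ 2) (by positivity) A hR T
  have hsd : 1 ≤ √(d : ℝ) := Real.one_le_sqrt.2 (by exact_mod_cast hd)
  have hB1 : √(1 / B ^ 2) * B = 1 := by
    rw [one_div, Real.sqrt_inv, Real.sqrt_sq hB.le, inv_mul_cancel₀ hB.ne']
  have h1 : √(d * logRatio (1 / B ^ 2) A R T * Real.log (4 * T ^ 2 / δ)) ≤ 4 * (√(d : ℝ) * x) := by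
    refine Real.sqrt_le_iff.2 ⟨by positivity, ?_⟩
    calc d * logRatio (1 / B ^ 2) A R T * Real.log (4 * T ^ 2 / δ)
        ≤ d * logRatio (1 / B ^ 2) A R T * (5 * x) := by gcongr
      _ ≤ d * (3 * x) * (5 * x) := by gcongr
      _ ≤ (4 * (√(d : ℝ) * x)) ^ 2 := by
        rw [mul_pow, mul_pow, Real.sq_sqrt (by positivity)]
        have : 0 ≤ d * x ^ 2 := by positivity
        linarith
  have h2 : √(d : ℝ) * Real.log (4 * T ^ 2 / δ) ≤ √(d : ℝ) * (5 * x) := by gcongr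
  have h3 : 1 ≤ √(d : ℝ) * x := one_le_mul_of_one_le_of_one_le hsd hx
  have h4 : √(d : ℝ) * x ≤ C / c₀ * (√(d : ℝ) * x) :=
    le_mul_of_one_le_left (by positivity) ((one_le_div hc₀).2 hC)
  have hC0 : 0 < C := hc₀.trans_le hC
  have h5 : C * √(d : ℝ) ≤ C * √(d : ℝ) * x := le_mul_of_one_le_right (by positivity) hx
  rw [radius_eq, noiseRadius, hB1]
  calc 8 * √(d * logRatio (1 / B ^ 2) A R T * Real.log (4 * T ^ 2 / δ))
        + 4 * √(d : ℝ) * Real.log (4 * T ^ 2 / δ) + C * √(d : ℝ) + 1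
      ≤ 53 * (C / c₀ * (√(d : ℝ) * x)) + C * √(d : ℝ) * x := by linarith
    _ = (53 / c₀ + 1) * (C * √(d : ℝ) * x) := by ring

/-- Collecting the logarithmic factors. -/
theorem regret_factor_le {c₀ : ℝ} (hd : 0 < d) (hA : 0 ≤ A) (hB : 0 < B) (hc₀ : 0 < c₀)
    (hR : c₀ ≤ R) (hC : c₀ ≤ C) (hδ : 0 < δ) (hδ1 : δ < 1) {S : ℝ} (hS : 0 ≤ S) :
    2 * (1 + 1 / c₀ ^ 2) * radius d (1 / B ^ 2) A B R C δ T *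
      ((√T * ((R + 1) / √(d : ℝ)) + S) * √(2 * (d * logRatio (1 / B ^ 2) A R T)))
    ≤ 6 * (1 + 1 / c₀ ^ 2) * (53 / c₀ + 1) * (1 + 1 / c₀) * Real.log (logArg T A B δ) ^ 2 *
      (C * d * S + C * R * √(d * T)) := by
  have hR0 : 0 < R := hc₀.trans_le hR
  have hC0 : 0 < C := hc₀.trans_le hC
  have hrad := radius_le (T := T) hd hA hB hR0.le hc₀ hC hδ hδ1
  have hx := one_le_log_logArg (T := T) hA hB hδ hδ1
  have hL := logRatio_le (T := T) hA hB hR0.le hδ hδ1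
  set x := Real.log (logArg T A B δ) with hxdef
  have hsd : 0 < √(d : ℝ) := by positivity
  have hdd : √(d : ℝ) * √(d : ℝ) = d := Real.mul_self_sqrt (by positivity)
  have h1 : √(2 * (d * logRatio (1 / B ^ 2) A R T)) ≤ 3 * (√(d : ℝ) * x) := by
    refine Real.sqrt_le_iff.2 ⟨by positivity, ?_⟩
    calc 2 * (d * logRatio (1 / B ^ 2) A R T) ≤ 2 * (d * (3 * x)) := by gcongr
      _ ≤ 9 * (d * (x * x)) := by
        have : d * x ≤ d * (x * x) := by gcongr; nlinarith
        have : 0 ≤ d * x := by positivity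
        linarith
      _ = (3 * (√(d : ℝ) * x)) ^ 2 := by
        rw [mul_pow, mul_pow, Real.sq_sqrt (by positivity)]
        ring
  have hR1 : R + 1 ≤ (1 + 1 / c₀) * R := by
    have : 1 ≤ 1 / c₀ * R := by rw [one_div_mul_eq_div, one_le_div hc₀]; exact hR
    linarith
  have h2 : S ≤ (1 + 1 / c₀) * S := le_mul_of_one_le_left hS (by
    have : 0 ≤ 1 / c₀ := by positivity
    linarith)
  calc _ ≤ 2 * (1 + 1 / c₀ ^ 2) * ((53 / c₀ + 1) * (C * √(d : ℝ) * x)) *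
        ((√T * (((1 + 1 / c₀) * R) / √(d : ℝ)) + (1 + 1 / c₀) * S) * (3 * (√(d : ℝ) * x))) := by
        gcongr
    _ = 6 * (1 + 1 / c₀ ^ 2) * (53 / c₀ + 1) * (1 + 1 / c₀) * x ^ 2 *
        (C * (√(d : ℝ) * √(d : ℝ)) * S + C * R * (√(d : ℝ) * √T)) := by
        field_simp
        ring
    _ = _ := by rw [hdd, Real.sqrt_mul (by positivity)]

end Logarithms

end Regret

/-! ### The bandit model -/

section Bandit

variable {Ω : Type*} [mΩ : MeasurableSpace Ω] {P : Measure Ω} {d T : ℕ} {A B R C : ℝ} {I : Run Ω d}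

theorem isNoiseModel (h : I.IsCorruptedBandit P T A B R C) :
    IsNoiseModel I.info P T A R I.act I.obsSd fun t ω => I.noise t (I.act t ω) ω where
  meas_act t ht := (h.act_admissible t ht).1
  meas_sd t ht := h.sd_measurable t ht _ (h.act_admissible t ht)
  meas_noise t ht := h.noise_measurable t ht _ (h.act_admissible t ht)
  norm_act t ht := by
    filter_upwards [h.norm_le t ht, (h.act_admissible t ht).2] with ω h1 h2 using h1 _ h2
  sd_nonneg t ht := by
    filter_upwards [h.sd_nonneg t ht, (h.act_admissible t ht).2] with ω h1 h2 using h1 _ h2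
  abs_noise t ht := by
    filter_upwards [h.noise_le t ht, (h.act_admissible t ht).2] with ω h1 h2 using h1 _ h2
  mean t ht := h.noise_mean t ht _ (h.act_admissible t ht)
  var t ht := h.noise_var t ht _ (h.act_admissible t ht)

theorem sum_abs_corruption_le (hR : 0 ≤ R) (hC : 0 ≤ C) {ω : Ω}
    (hω : I.corruption T R ω ≤ ENNReal.ofReal C) (hD : ∀ t ∈ Finset.Icc 1 T, I.act t ω ∈ I.D t ω) :
    ∑ t ∈ Finset.Icc 1 T, |I.obsReward t ω - I.stochReward t (I.act t ω) ω| ≤ C * (R + 1) := by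
  have hR1 : 0 < R + 1 := by linarith
  rw [Run.corruption, ENNReal.div_le_iff (by simpa using hR1) ENNReal.ofReal_ne_top,
    ← ENNReal.ofReal_mul hC] at hω
  refine (ENNReal.ofReal_le_ofReal_iff (by positivity)).1 (le_trans ?_ hω)
  rw [ENNReal.ofReal_sum_of_nonneg fun _ _ => abs_nonneg _]
  refine Finset.sum_le_sum fun t ht => ?_
  rw [abs_sub_comm]
  exact le_iSup₂ (f := fun a (_ : a ∈ I.D t ω) =>
    ENNReal.ofReal |I.stochReward t a ω - I.reward t a ω|) (I.act t ω) (hD t ht)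

/-- On a trajectory along which the noise stays within the confidence radius, the regret is small. -/
theorem regret_le_of_noise_le {c₀ δ : ℝ} (hd : 0 < d) (hA : 0 ≤ A) (hB : 0 < B) (hc₀ : 0 < c₀)
    (hR : c₀ ≤ R) (hC : c₀ ≤ C) (hδ : 0 < δ) (hδ1 : δ < 1) (hθ : ‖I.theta‖ ≤ B) {ω : Ω}
    (hD : ∀ t ∈ Finset.Icc 1 T, I.act t ω ∈ I.D t ω)
    (hmax : ∀ t ∈ Finset.Icc 1 T, IsMaxOn (optValue (confSet (1 / B ^ 2) A B R C δ
      (fun i => I.act i ω) (fun i => I.obsSd i ω) (fun i => I.obsReward i ω) t)) (I.D t ω)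
      (I.act t ω))
    (hnorm : ∀ t ∈ Finset.Icc 1 T, ∀ a ∈ I.D t ω, ‖a‖ ≤ A)
    (hmean : ∀ t ∈ Finset.Icc 1 T, ∀ a ∈ I.D t ω, |(inner ℝ a I.theta : ℝ)| ≤ 1)
    (hcorr : I.corruption T R ω ≤ ENNReal.ofReal C)
    (hnoise : ∀ t ∈ Finset.Icc 1 T,
      invNorm (CorruptedBandit.gram (1 / B ^ 2) R (fun i => I.act i ω) (fun i => I.obsSd i ω) t)
        (noiseSum R (fun i => I.act i ω) (fun i => I.obsSd i ω)
          (fun i => I.noise i (I.act i ω) ω) t) ≤ noiseRadius d (1 / B ^ 2) A R δ t) :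
    I.regret T ω ≤ 6 * (1 + 1 / c₀ ^ 2) * (53 / c₀ + 1) * (1 + 1 / c₀)
      * Real.log (logArg T A B δ) ^ 2 *
        (C * d * √(∑ t ∈ Finset.Icc 1 T, I.obsSd t ω ^ 2) + C * R * √(d * T)) := by
  have hR0 : 0 < R := hc₀.trans_le hR
  have hC0 : 0 < C := hc₀.trans_le hC
  have hlam : 0 < 1 / B ^ 2 := by positivity
  have hsd : 0 < √(d : ℝ) := by positivity
  rcases Nat.eq_zero_or_pos T with hT | hT
  · subst hT
    simp [Run.regret]
  have hconf : ∀ t ∈ Finset.Icc 1 T, matNorm (CorruptedBandit.gram (1 / B ^ 2) R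
      (fun i => I.act i ω) (fun i => I.obsSd i ω) t) (I.theta - estimate (1 / B ^ 2) R
      (fun i => I.act i ω) (fun i => I.obsSd i ω) (fun i => I.obsReward i ω) t)
        ≤ radius d (1 / B ^ 2) A B R C δ t := by
    intro t ht
    refine (matNorm_sub_estimate_le hd hlam hR0.le _ _ (fun i => I.noise i (I.act i ω) ω) _
      (fun i => I.obsReward i ω - I.stochReward i (I.act i ω) ω) t hB.le hθ
      (fun i _ => by rw [Run.stochReward]; ring) (C := C) ?_).trans ?_
    · refine (Finset.sum_le_sum_of_subset_of_nonneg (fun i hi => ?_)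
        fun _ _ _ => abs_nonneg _).trans (sum_abs_corruption_le hR0.le hC0.le hcorr hD)
      simp at hi ht ⊢
      omega
    · rw [radius_eq]
      linarith [hnoise t ht]
  have hmono : ∀ t ∈ Finset.Icc 1 T,
      radius d (1 / B ^ 2) A B R C δ t ≤ radius d (1 / B ^ 2) A B R C δ T := by
    intro t ht
    obtain ⟨h1, h2⟩ := Finset.mem_Icc.1 ht
    rw [radius_eq, radius_eq]
    linarith [noiseRadius_mono d hlam A hR0.le hδ hδ1 h1 h2]
  have hrad : C * √(d : ℝ) ≤ radius d (1 / B ^ 2) A B R C δ T := by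
    rw [radius_eq]
    have := noiseRadius_nonneg d (1 / B ^ 2) A R hδ hδ1 hT
    have : 0 ≤ √(1 / B ^ 2) * B := by positivity
    linarith
  have hα : ∀ s : ℝ, c₀ ^ 2 ≤ radius d (1 / B ^ 2) A B R C δ T * sdBar d R s := by
    intro s
    calc c₀ ^ 2 ≤ C * (R + 1) := by nlinarith
      _ = C * √(d : ℝ) * ((R + 1) / √(d : ℝ)) := by field_simp
      _ ≤ radius d (1 / B ^ 2) A B R C δ T * sdBar d R s := by
        have : (R + 1) / √(d : ℝ) ≤ sdBar d R s := le_max_left _ _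
        gcongr
        exact (by positivity : 0 ≤ C * √(d : ℝ)).trans hrad
  refine (sum_regret_le hd hlam (A := A) (α := radius d (1 / B ^ 2) A B R C δ T) hR0.le hc₀ hα
    ((by positivity : 0 ≤ C * √(d : ℝ)).trans hrad)
    (fun i => I.act i ω) (fun i => I.obsSd i ω) _ T (fun t ht => hnorm t ht _ (hD t ht))
    (fun t ht => sSup_sub_inner_le_two (hD t ht) (hmean t ht)) fun t ht => ?_).trans
    (regret_factor_le hd hA hB hc₀ hR hC hδ hδ1 (Real.sqrt_nonneg _))
  have h1 := sSup_sub_inner_le (gram_posDef hlam R (fun i => I.act i ω) (fun i => I.obsSd i ω) t)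
    (hconf t ht) (hD t ht) (hmax t ht)
  have h2 := invNorm_act hd hR0.le (1 / B ^ 2) (fun i => I.act i ω) (fun i => I.obsSd i ω) t
  refine h1.trans (le_of_le_of_eq ?_ (congrArg _ h2))
  have := hmono t ht
  have := invNorm_nonneg (Z := CorruptedBandit.gram (1 / B ^ 2) R (fun i => I.act i ω)
    (fun i => I.obsSd i ω) t) (I.act t ω).ofLp
  gcongr

/-- The high-probability regret bound with an explicit constant. -/
theorem exists_measurableSet_regret_le [IsProbabilityMeasure P] {c₀ δ : ℝ} (hd : 0 < d)
    (hA : 0 ≤ A) (hB : 0 < B) (hc₀ : 0 < c₀) (hR : c₀ ≤ R) (hC : c₀ ≤ C) (hδ : 0 < δ) (hδ1 : δ < 1)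
    (h : I.IsCorruptedBandit P T A B R C) (hplay : I.PlaysRobustOFUL P T (1 / B ^ 2) A B R C δ) :
    ∃ S : Set Ω, MeasurableSet S ∧ ENNReal.ofReal (1 - δ) ≤ P S ∧ ∀ ω ∈ S,
      I.regret T ω ≤ 6 * (1 + 1 / c₀ ^ 2) * (53 / c₀ + 1) * (1 + 1 / c₀)
        * Real.log (logArg T A B δ) ^ 2 *
          (C * d * √(∑ t ∈ Finset.Icc 1 T, I.obsSd t ω ^ 2) + C * R * √(d * T)) := by
  have hnoise := (isNoiseModel h).measure_noise_gt_le hd (hc₀.le.trans hR)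
    (show 0 < 1 / B ^ 2 by positivity) hδ hδ1
  set bad : Set Ω := {ω | ∃ t ∈ Finset.Icc 1 T, noiseRadius d (1 / B ^ 2) A R δ t
    < invNorm (CorruptedBandit.gram (1 / B ^ 2) R (fun i => I.act i ω) (fun i => I.obsSd i ω) t)
      (noiseSum R (fun i => I.act i ω) (fun i => I.obsSd i ω)
        (fun i => I.noise i (I.act i ω) ω) t)}
  have hplay' := (Finset.eventually_all _).2 hplay
  have hnorm := (Finset.eventually_all _).2 h.norm_le
  have hmean := (Finset.eventually_all _).2 h.mean_le
  have hregret : ∀ᵐ ω ∂P, ω ∉ bad →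
      I.regret T ω ≤ 6 * (1 + 1 / c₀ ^ 2) * (53 / c₀ + 1) * (1 + 1 / c₀)
        * Real.log (logArg T A B δ) ^ 2 *
          (C * d * √(∑ t ∈ Finset.Icc 1 T, I.obsSd t ω ^ 2) + C * R * √(d * T)) := by
    filter_upwards [hplay', hnorm, hmean, h.corruption_le] with ω h1 h2 h3 h4 h5
    refine regret_le_of_noise_le hd hA hB hc₀ hR hC hδ hδ1 h.norm_theta (fun t ht => (h1 t ht).1)
      (fun t ht => (h1 t ht).2) h2 h3 h4 fun t ht => ?_
    by_contra! hlt
    exact h5 ⟨t, ht, hlt⟩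
  set E : Set Ω := bad ∪ {ω | ¬ (ω ∉ bad →
      I.regret T ω ≤ 6 * (1 + 1 / c₀ ^ 2) * (53 / c₀ + 1) * (1 + 1 / c₀)
        * Real.log (logArg T A B δ) ^ 2 *
          (C * d * √(∑ t ∈ Finset.Icc 1 T, I.obsSd t ω ^ 2) + C * R * √(d * T)))} with hE
  have hPE : P E ≤ ENNReal.ofReal δ := by
    refine (measure_union_le _ _).trans ?_
    rw [ae_iff.1 hregret, add_zero]
    exact hnoise
  refine ⟨(toMeasurable P E)ᶜ, (measurableSet_toMeasurable P E).compl, ?_, fun ω hω => ?_⟩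
  · rw [prob_compl_eq_one_sub (measurableSet_toMeasurable P E), measure_toMeasurable,
      ENNReal.ofReal_sub _ hδ.le, ENNReal.ofReal_one]
    exact tsub_le_tsub_left hPE 1
  · have h1 : ω ∉ E := fun h2 => hω (subset_toMeasurable P E h2)
    rw [hE, Set.mem_union, not_or] at h1
    exact not_not.1 h1.2 h1.1

end Bandit

end RobustOFUL

theorem theorem4p2 :
    ∃ k : ℕ, ∀ c₀ : ℝ, 0 < c₀ → ∃ K : ℝ, 0 < K ∧
      ∀ (d T : ℕ) (A B R C δ : ℝ), 0 < d → 0 ≤ A → 0 < B → c₀ ≤ R → c₀ ≤ C → 0 < δ → δ < 1 →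
      ∀ (Ω : Type*) [MeasurableSpace Ω] (P : Measure Ω) [IsProbabilityMeasure P]
        (I : CorruptedBandit.Run Ω d),
        I.IsCorruptedBandit P T A B R C →
        I.PlaysRobustOFUL P T (1 / B ^ 2) A B R C δ →
        ∃ S : Set Ω, MeasurableSet S ∧ ENNReal.ofReal (1 - δ) ≤ P S ∧ ∀ ω ∈ S,
          I.regret T ω ≤ K * Real.log (2 + T + A * B + 1 / δ) ^ k *
            (C * d * √(∑ t ∈ Finset.Icc 1 T, I.obsSd t ω ^ 2) + C * R * √(d * T)) := by
  refine ⟨2, fun c₀ hc₀ => ⟨6 * (1 + 1 / c₀ ^ 2) * (53 / c₀ + 1) * (1 + 1 / c₀), by positivity, ?_⟩⟩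
  intro d T A B R C δ hd hA hB hR hC hδ hδ1 Ω _ P _ I h hplay
  exact RobustOFUL.exists_measurableSet_regret_le hd hA hB hc₀ hR hC hδ hδ1 h hplay
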